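/- Let $N\ge 1$. A two-coloured partition $p$ with $k$ upper and $l$ lower points is a partition of these $k+l$ points into blocks together with colour words $\omega\in\{1,*\}^k$ (upper points) and $\omega'\in\{1,*\}^l$ (lower points), where $1$ is white and $*$ is black. A category of partitions is a set of two-coloured partitions that is closed under tensor product (horizontal concatenation), involution (reflection at the horizontal axis) and composition (vertical concatenation along equal colour words), and that contains the white and the black identity partition and the four mixed-coloured pair partitions (one block of two points of different colours, both lower or both upper, in either order). Let $\langle\Pi\rangle$ be the smallest category of partitions containing $\Pi$. For $p$ as above let $r=N^{tb(p)}$, where $tb(p)$ is the number of blocks with both upper and lower points (through-blocks). A labeling of a row of $p$ by elements of $[N]=\{1,\dots,N\}$ is valid if connected points have equal labels. Let $T_0\subseteq[N]^k$ and $T'_0\subseteq[N]^l$ be the invalid labelings of the upper and lower row, and for the $i$-th of the $r$ labelings of the through-blocks let $T_i$ and $T'_i$ be the valid labelings of the upper and lower row that restrict to it. For $x=(x_{ij})_{i,j\in[N]}$ let $R^{Sp}_p(x)$ be the relations $$\sum_{t\in T_i}x_{t_1\gamma_1}^{\omega_1}\cdots x_{t_k\gamma_k}^{\omega_k}=\sum_{t'\in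 T'_i}x_{t'_1\gamma'_1}^{\omega'_1}\cdots x_{t'_l\gamma'_l}^{\omega'_l}\quad(1\le i,j\le r,\ \gamma\in T_j,\ \gamma'\in T'_j),$$ $$\sum_{t\in T_i}x_{t_1\gamma_1}^{\omega_1}\cdots x_{t_k\gamma_k}^{\omega_k}=0\quad(\gamma\in T_0),\qquad \sum_{t'\in T'_i}x_{t'_1\gamma'_1}^{\omega'_1}\cdots x_{t'_l\gamma'_l}^{\omega'_l}=0\quad(\gamma'\in T'_0)\qquad(1\le i\le r),$$ an empty product being $1$. For a set $\Pi$ of two-coloured partitions containing the four mixed-coloured pair partitions, let $C(X_{N,N}(\Pi))$ be the universal unital $C^*$-algebra generated by $x_{ij}$, $i,j\in[N]$, subject to $R^{Sp}_p(x)$ for all $p\in\Pi$. A compact matrix quantum group $G$ (of size $N$) is a unital $C^*$-algebra $C(G)$ generated by the entries of an $N\times N$ matrix $u=(u_{ij})$ such that $u$ and $\bar u=(u_{ij}^*)$ are invertible and there is a $*$-homomorphism $\Delta:C(G)\to C(G)\otimes C(G)$ with $\Delta(u_{ij})=\sum_k u_{ik}\otimes u_{kj}$ (minimal tensor product). Write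 $G'\subseteq G$ if there is a $*$-homomorphism $C(G)\to C(G')$ mapping $u_{ij}$ to the corresponding generator $u'_{ij}$; two such quantum groups are identified if there is a $*$-isomorphism with this property. $G$ is the quantum symmetry group of $X_{N,N}(\Pi)$ if there are unital $*$-homomorphisms $\alpha,\beta:C(X_{N,N}(\Pi))\to C(G)\otimes C(X_{N,N}(\Pi))$ with $\alpha(x_{ij})=\sum_k u_{ik}\otimes x_{kj}$ and $\beta(x_{ij})=\sum_k u_{ki}\otimes x_{kj}$, and every compact matrix quantum group $G'$ of size $N$ that admits such maps satisfies $G'\subseteq G$. Claim: if $\Pi$ and $\Pi'$ are sets of two-coloured partitions containing the four mixed-coloured pair partitions and $\langle\Pi\rangle=\langle\Pi'\rangle$, then $X_{N,N}(\Pi)$ has a quantum symmetry group, a compact matrix quantum group is the quantum symmetry group of $X_{N,N}(\Pi)$ if and only if it is the quantum symmetry group of $X_{N,N}(\Pi')$, and the quantum symmetry groups of $X_{N,N}(\Pi)$ and $X_{N,N}(\Pi')$ coincide up to the identification above. -/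

import Mathlib

open scoped TensorProduct ComplexOrder

universe u v

noncomputable section

/-- A C⋆-seminorm on a unital complex ⋆-algebra. -/
structure CStarSeminorm (A : Type u) [Ring A] [StarRing A] [Algebra ℂ A] where
  toFun : A → ℝ
  map_zero : toFun 0 = 0
  add_le : ∀ a b, toFun (a + b) ≤ toFun a + toFun b
  map_smul : ∀ (c : ℂ) a, toFun (c • a) = ‖c‖ * toFun a
  mul_le : ∀ a b, toFun (a * b) ≤ toFun a * toFun b
  map_star_mul_self : ∀ a, toFun (star a * a) = toFun a ^ 2

namespace CStarSeminorm

section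

variable {A : Type u} [Ring A] [StarRing A] [Algebra ℂ A]

lemma map_neg (q : CStarSeminorm A) (a : A) : q.toFun (-a) = q.toFun a := by
  simpa using q.map_smul (-1) a

lemma nonneg (q : CStarSeminorm A) (a : A) : 0 ≤ q.toFun a := by
  have h := q.add_le a (-a)
  rw [add_neg_cancel, q.map_zero, q.map_neg] at h
  linarith

lemma le_star (q : CStarSeminorm A) (a : A) : q.toFun a ≤ q.toFun (star a) := by
  have h := q.mul_le (star a) a
  rw [q.map_star_mul_self, sq] at h
  rcases (q.nonneg a).eq_or_lt with h0 | h0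
  · rw [← h0]; exact q.nonneg _
  · exact le_of_mul_le_mul_right h h0

lemma map_star (q : CStarSeminorm A) (a : A) : q.toFun (star a) = q.toFun a :=
  le_antisymm (by simpa using q.le_star (star a)) (q.le_star a)

/-- The C⋆-seminorm `a ↦ ‖π a‖` of a unital ⋆-homomorphism into a C⋆-algebra. -/
def ofStarAlgHom {B : Type v} [CStarAlgebra B] (π : A →⋆ₐ[ℂ] B) : CStarSeminorm A where
  toFun a := ‖π a‖
  map_zero := by simp
  add_le a b := by rw [map_add]; exact norm_add_le _ _
  map_smul c a := by rw [_root_.map_smul, norm_smul]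
  mul_le a b := by rw [map_mul]; exact norm_mul_le _ _
  map_star_mul_self a := by
    rw [map_mul, StarHomClass.map_star, CStarRing.norm_star_mul_self, sq]

/-- The pointwise supremum of a pointwise bounded set of C⋆-seminorms. -/
def sup (S : Set (CStarSeminorm A)) (hS : ∀ a, ∃ C, ∀ q ∈ S, q.toFun a ≤ C) :
    CStarSeminorm A where
  toFun a := ⨆ q : S, q.1.toFun a
  map_zero := by simp [CStarSeminorm.map_zero]
  add_le a b := by
    have hb : ∀ a, BddAbove (Set.range fun q : S => q.1.toFun a) := fun a => by
      obtain ⟨C, hC⟩ := hS a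
      exact ⟨C, by rintro _ ⟨q, rfl⟩; exact hC q.1 q.2⟩
    refine Real.iSup_le (fun q => (q.1.add_le a b).trans ?_) ?_
    · exact add_le_add (le_ciSup (hb a) q) (le_ciSup (hb b) q)
    · exact add_nonneg (Real.iSup_nonneg fun q => q.1.nonneg a)
        (Real.iSup_nonneg fun q => q.1.nonneg b)
  map_smul c a := by
    simp_rw [CStarSeminorm.map_smul]
    exact (Real.mul_iSup_of_nonneg (norm_nonneg c) _).symm
  mul_le a b := by
    have hb : ∀ a, BddAbove (Set.range fun q : S => q.1.toFun a) := fun a => by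
      obtain ⟨C, hC⟩ := hS a
      exact ⟨C, by rintro _ ⟨q, rfl⟩; exact hC q.1 q.2⟩
    have h0 : ∀ a, 0 ≤ ⨆ q : S, q.1.toFun a := fun a => Real.iSup_nonneg fun q => q.1.nonneg a
    refine Real.iSup_le (fun q => (q.1.mul_le a b).trans ?_) (mul_nonneg (h0 a) (h0 b))
    exact mul_le_mul (le_ciSup (hb a) q) (le_ciSup (hb b) q) (q.1.nonneg b) (h0 a)
  map_star_mul_self a := by
    have hb : ∀ a, BddAbove (Set.range fun q : S => q.1.toFun a) := fun a => by
      obtain ⟨C, hC⟩ := hS a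
      exact ⟨C, by rintro _ ⟨q, rfl⟩; exact hC q.1 q.2⟩
    have h0 : ∀ a, 0 ≤ ⨆ q : S, q.1.toFun a := fun a => Real.iSup_nonneg fun q => q.1.nonneg a
    apply le_antisymm
    · refine Real.iSup_le (fun q => ?_) (sq_nonneg _)
      rw [q.1.map_star_mul_self]
      exact pow_le_pow_left₀ (q.1.nonneg a) (le_ciSup (hb a) q) 2
    · apply Real.le_sqrt (h0 a) (h0 _) |>.1
      refine Real.iSup_le (fun q => ?_) (Real.sqrt_nonneg _)
      apply Real.le_sqrt (q.1.nonneg a) (h0 _) |>.2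
      rw [← q.1.map_star_mul_self]
      exact le_ciSup (hb (star a * a)) q

/-- The ⋆-algebra `A` equipped with the C⋆-seminorm `q`. -/
def Pre (_q : CStarSeminorm A) : Type u := A

variable (q : CStarSeminorm A)

instance : Ring q.Pre := inferInstanceAs (Ring A)
instance : StarRing q.Pre := inferInstanceAs (StarRing A)
instance : Algebra ℂ q.Pre := inferInstanceAs (Algebra ℂ A)

/-- The seminorm `q` as a group seminorm. -/
def toAddGroupSeminorm : AddGroupSeminorm q.Pre where
  toFun := q.toFun
  map_zero' := q.map_zero
  add_le' := q.add_le
  neg' := q.map_neg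

instance : SeminormedRing q.Pre where
  __ := q.toAddGroupSeminorm.toSeminormedAddCommGroup
  __ := (inferInstance : Ring q.Pre)
  norm_mul_le := q.mul_le

lemma pre_norm_def (a : q.Pre) : ‖a‖ = q.toFun a := rfl

instance : NormedAlgebra ℂ q.Pre where
  norm_smul_le c a := (q.map_smul c a).le

instance [StarModule ℂ A] : StarModule ℂ q.Pre := inferInstanceAs (StarModule ℂ A)

instance : NormedStarGroup q.Pre where
  norm_star_le a := (q.map_star a).le

/-- The separated completion of `A` with respect to the C⋆-seminorm `q`. -/
abbrev Completion : Type u := UniformSpace.Completion q.Pre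

lemma uniformContinuous_star_pre : UniformContinuous (star : q.Pre → q.Pre) :=
  (AddMonoidHomClass.isometry_of_norm (starAddEquiv : q.Pre ≃+ q.Pre) q.map_star).uniformContinuous

instance : Star q.Completion := ⟨UniformSpace.Completion.map star⟩

instance : ContinuousStar q.Completion := ⟨UniformSpace.Completion.continuous_map⟩

lemma star_coe (a : q.Pre) : star (a : q.Completion) = ((star a : q.Pre) : q.Completion) :=
  UniformSpace.Completion.map_coe q.uniformContinuous_star_pre a

instance : StarRing q.Completion where
  star_involutive x := by
    induction x using UniformSpace.Completion.induction_on with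
    | hp => exact isClosed_eq (by fun_prop) (by fun_prop)
    | ih a => rw [star_coe, star_coe, star_star]
  star_mul x y := by
    induction x, y using UniformSpace.Completion.induction_on₂ with
    | hp => exact isClosed_eq (by fun_prop) (by fun_prop)
    | ih a b =>
      rw [star_coe, star_coe, ← UniformSpace.Completion.coe_mul, star_coe, star_mul,
        UniformSpace.Completion.coe_mul]
  star_add x y := by
    induction x, y using UniformSpace.Completion.induction_on₂ with
    | hp => exact isClosed_eq (by fun_prop) (by fun_prop)
    | ih a b =>
      rw [star_coe, star_coe, ← UniformSpace.Completion.coe_add, star_coe, star_add,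
        UniformSpace.Completion.coe_add]

instance : NormedAlgebra ℂ q.Completion where
  norm_smul_le := norm_smul_le

instance [StarModule ℂ A] : StarModule ℂ q.Completion where
  star_smul c x := by
    induction x using UniformSpace.Completion.induction_on with
    | hp =>
      exact isClosed_eq (continuous_id.const_smul c).star (continuous_star.const_smul (star c))
    | ih a =>
      rw [star_coe, ← UniformSpace.Completion.coe_smul, star_coe, star_smul,
        UniformSpace.Completion.coe_smul]

instance : CStarRing q.Completion where
  norm_mul_self_le x := by
    induction x using UniformSpace.Completion.induction_on with
    | hp => exact isClosed_le (by fun_prop) (by fun_prop)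
    | ih a =>
      rw [star_coe, ← UniformSpace.Completion.coe_mul, UniformSpace.Completion.norm_coe,
        UniformSpace.Completion.norm_coe, pre_norm_def, pre_norm_def, ← sq]
      exact (q.map_star_mul_self a).ge

instance [StarModule ℂ A] : CStarAlgebra q.Completion where

/-- The canonical map from `A` into its completion. -/
def toCompletion [StarModule ℂ A] : A →⋆ₐ[ℂ] q.Completion where
  toFun a := ((show q.Pre from a : q.Pre) : q.Completion)
  map_one' := UniformSpace.Completion.coe_one q.Pre
  map_mul' a b := UniformSpace.Completion.coe_mul (α := q.Pre) a b
  map_zero' := UniformSpace.Completion.coe_zero (α := q.Pre)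
  map_add' a b := UniformSpace.Completion.coe_add (α := q.Pre) a b
  commutes' _ := rfl
  map_star' a := (q.star_coe a).symm

end

end CStarSeminorm

/-! ### The free ⋆-algebra -/

/-- The two colours of points: white corresponds to the exponent `1`, black to `*`. -/
inductive Colour
  | white
  | black

/-- The opposite colour. -/
def Colour.flip : Colour → Colour
  | white => black
  | black => white

/-- `a ^ ω` for a colour `ω`, i.e. `a` if `ω` is white and `star a` if `ω` is black. -/
def Colour.pow {A : Type u} [Star A] (a : A) : Colour → A
  | white => a
  | black => star a

/-- The free unital complex ⋆-algebra on a set `X` of generators: noncommutative polynomials in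
the letters `(x, white)`, standing for `x`, and `(x, black)`, standing for `star x`. -/
def FreeStarAlgebra (X : Type u) : Type u := FreeAlgebra ℂ (X × Colour)

namespace FreeStarAlgebra

variable {X : Type u}

instance : Ring (FreeStarAlgebra X) := inferInstanceAs (Ring (FreeAlgebra ℂ (X × Colour)))
instance : Algebra ℂ (FreeStarAlgebra X) :=
  inferInstanceAs (Algebra ℂ (FreeAlgebra ℂ (X × Colour)))

/-- The letter `(x, c)`. -/
def letter (x : X) (c : Colour) : FreeStarAlgebra X := FreeAlgebra.ι ℂ (x, c)

/-- The generator `x`. -/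
def of (x : X) : FreeStarAlgebra X := letter x .white

@[elab_as_elim]
lemma induction {C : FreeStarAlgebra X → Prop}
    (algebraMap : ∀ r, C (algebraMap ℂ (FreeStarAlgebra X) r)) (letter : ∀ x c, C (letter x c))
    (mul : ∀ a b, C a → C b → C (a * b)) (add : ∀ a b, C a → C b → C (a + b))
    (a : FreeStarAlgebra X) : C a :=
  FreeAlgebra.induction ℂ (X × Colour) algebraMap (fun x => letter x.1 x.2) mul add a

/-- The opposite algebra with conjugated scalars. -/
abbrev conjOpAlgebra : Algebra ℂ (FreeStarAlgebra X)ᵐᵒᵖ :=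
  ((algebraMap ℂ (FreeStarAlgebra X)ᵐᵒᵖ).comp (starRingEnd ℂ)).toAlgebra'
    fun c x => Algebra.commutes (starRingEnd ℂ c) x

/-- The involution as a ring homomorphism into the opposite ring: it reverses words, exchanges
the two letters of each generator and conjugates the coefficients. -/
def starHom : FreeStarAlgebra X →+* (FreeStarAlgebra X)ᵐᵒᵖ :=
  RingHomClass.toRingHom (@FreeAlgebra.lift ℂ (X × Colour) _ (FreeStarAlgebra X)ᵐᵒᵖ _ conjOpAlgebra
    fun x => MulOpposite.op (letter x.1 x.2.flip))

lemma starHom_algebraMap (c : ℂ) : starHom (algebraMap ℂ (FreeStarAlgebra X) c) =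
    MulOpposite.op (algebraMap ℂ (FreeStarAlgebra X) (starRingEnd ℂ c)) :=
  @AlgHom.commutes ℂ (FreeAlgebra ℂ (X × Colour)) (FreeStarAlgebra X)ᵐᵒᵖ _ _ _ _ conjOpAlgebra _ c

lemma starHom_letter (x : X) (c : Colour) :
    starHom (letter x c) = MulOpposite.op (letter x c.flip) :=
  @FreeAlgebra.lift_ι_apply ℂ (X × Colour) _ (FreeStarAlgebra X)ᵐᵒᵖ _ conjOpAlgebra _ (x, c)

instance : StarRing (FreeStarAlgebra X) where
  star a := (starHom a).unop
  star_involutive a := by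
    induction a using induction with
    | algebraMap r => simp [starHom_algebraMap]
    | letter x c => cases c <;> simp [starHom_letter, Colour.flip]
    | mul a b ha hb => simp [ha, hb]
    | add a b ha hb => simp [ha, hb]
  star_mul a b := by simp
  star_add a b := by simp

lemma star_def (a : FreeStarAlgebra X) : star a = (starHom a).unop := rfl

instance : StarModule ℂ (FreeStarAlgebra X) where
  star_smul c a := by
    rw [Algebra.smul_def, star_mul, Algebra.smul_def, star_def (algebraMap _ _ c),
      starHom_algebraMap, MulOpposite.unop_op, ← Algebra.commutes]
    rfl

/-- Evaluation of a noncommutative ⋆-polynomial at a family in a ⋆-algebra. -/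
def eval {B : Type v} [Ring B] [StarRing B] [Algebra ℂ B] [StarModule ℂ B] (y : X → B) :
    FreeStarAlgebra X →⋆ₐ[ℂ] B :=
  let f : FreeStarAlgebra X →ₐ[ℂ] B := FreeAlgebra.lift ℂ fun x : X × Colour => x.2.pow (y x.1)
  { f with
    map_star' := fun a => by
      have hl : ∀ x c, f (letter x c) = c.pow (y x) := fun x c => FreeAlgebra.lift_ι_apply _ _
      change f (star a) = star (f a)
      induction a using induction with
      | algebraMap r =>
        rw [star_def, starHom_algebraMap, MulOpposite.unop_op, f.commutes, f.commutes,
          ← algebraMap_star_comm]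
        rfl
      | letter x c =>
        rw [star_def, starHom_letter, MulOpposite.unop_op, hl, hl]
        cases c <;> simp [Colour.flip, Colour.pow]
      | mul a b ha hb => rw [star_mul, map_mul, map_mul, star_mul, ha, hb]
      | add a b ha hb => rw [star_add, map_add, map_add, star_add, ha, hb] }

lemma eval_letter {B : Type v} [Ring B] [StarRing B] [Algebra ℂ B] [StarModule ℂ B] (y : X → B)
    (x : X) (c : Colour) : eval y (letter x c) = c.pow (y x) :=
  FreeAlgebra.lift_ι_apply _ _

end FreeStarAlgebra

/-! ### Universal C⋆-algebras -/

/-- A family of relations on a set `X` of generators, i.e. a property of families `X → B` in unital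
C⋆-algebras `B`, such that the norm of every generator is uniformly bounded over all families
satisfying the relations. The last condition is the usual one for the existence of the universal
C⋆-algebra. -/
structure CStarRelations (X : Type u) where
  Holds : ∀ (B : Type u) [CStarAlgebra B], (X → B) → Prop
  bounded : ∀ x, ∃ C : ℝ, ∀ (B : Type u) [CStarAlgebra B] (y : X → B), Holds B y → ‖y x‖ ≤ C

namespace CStarRelations

variable {X : Type u} (R : CStarRelations X)

lemma eval_bounded (a : FreeStarAlgebra X) : ∃ C : ℝ, ∀ (B : Type u) [CStarAlgebra B] (y : X → B),
    R.Holds B y → ‖FreeStarAlgebra.eval y a‖ ≤ C := by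
  induction a using FreeStarAlgebra.induction with
  | algebraMap r =>
    refine ⟨‖r‖, fun B _ y _ => ?_⟩
    rw [AlgHomClass.commutes, Algebra.algebraMap_eq_smul_one, norm_smul]
    rcases subsingleton_or_nontrivial B with h | h
    · rw [Subsingleton.elim (1 : B) 0]; simp
    · simp
  | letter x c =>
    obtain ⟨C, hC⟩ := R.bounded x
    refine ⟨C, fun B _ y hy => ?_⟩
    rw [FreeStarAlgebra.eval_letter]
    cases c
    · exact hC B y hy
    · simpa [Colour.pow] using hC B y hy
  | mul a b ha hb =>
    obtain ⟨C, hC⟩ := ha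
    obtain ⟨D, hD⟩ := hb
    refine ⟨C * D, fun B _ y hy => ?_⟩
    rw [map_mul]
    exact (norm_mul_le _ _).trans (mul_le_mul (hC B y hy) (hD B y hy) (norm_nonneg _)
      ((norm_nonneg _).trans (hC B y hy)))
  | add a b ha hb =>
    obtain ⟨C, hC⟩ := ha
    obtain ⟨D, hD⟩ := hb
    refine ⟨C + D, fun B _ y hy => ?_⟩
    rw [map_add]
    exact (norm_add_le _ _).trans (add_le_add (hC B y hy) (hD B y hy))

/-- The seminorm `‖a‖ = sup ‖a(y)‖` on noncommutative ⋆-polynomials `a`, where `y` ranges over all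
families in unital C⋆-algebras satisfying the relations. -/
def universalSeminorm : CStarSeminorm (FreeStarAlgebra X) :=
  CStarSeminorm.sup
    {q | ∃ (B : Type u) (_ : CStarAlgebra B) (y : X → B), R.Holds B y ∧
      q = CStarSeminorm.ofStarAlgHom (FreeStarAlgebra.eval y)}
    (fun a => by
      obtain ⟨C, hC⟩ := R.eval_bounded a
      refine ⟨C, ?_⟩
      rintro _ ⟨B, _, y, hy, rfl⟩
      exact hC B y hy)

/-- The universal unital C⋆-algebra `C*(x ∈ X | R)`. -/
abbrev Universal : Type u := R.universalSeminorm.Completion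

/-- The canonical generators of the universal C⋆-algebra. -/
def gen (x : X) : R.Universal := R.universalSeminorm.toCompletion (FreeStarAlgebra.of x)

end CStarRelations

/-! ### The minimal tensor product -/

/-- The Hilbert space tensor product: the completion of the algebraic tensor product with respect
to the inner product `⟪x ⊗ y, x' ⊗ y'⟫ = ⟪x, x'⟫ * ⟪y, y'⟫`. -/
def HilbertTensor (H K : Type u) [NormedAddCommGroup H] [InnerProductSpace ℂ H]
    [NormedAddCommGroup K] [InnerProductSpace ℂ K] : Type u :=
  UniformSpace.Completion (H ⊗[ℂ] K)

section MinTensor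

variable {H K : Type u} [NormedAddCommGroup H] [InnerProductSpace ℂ H]
  [NormedAddCommGroup K] [InnerProductSpace ℂ K]

instance : NormedAddCommGroup (HilbertTensor H K) :=
  inferInstanceAs (NormedAddCommGroup (UniformSpace.Completion (H ⊗[ℂ] K)))
instance : InnerProductSpace ℂ (HilbertTensor H K) :=
  inferInstanceAs (InnerProductSpace ℂ (UniformSpace.Completion (H ⊗[ℂ] K)))
instance : CompleteSpace (HilbertTensor H K) :=
  inferInstanceAs (CompleteSpace (UniformSpace.Completion (H ⊗[ℂ] K)))

/-- The isometric embedding of the algebraic tensor product. -/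
def HilbertTensor.of : (H ⊗[ℂ] K) →ₗᵢ[ℂ] HilbertTensor H K :=
  (UniformSpace.Completion.toComplₗᵢ : (H ⊗[ℂ] K) →ₗᵢ[ℂ] UniformSpace.Completion (H ⊗[ℂ] K))

@[elab_as_elim]
lemma HilbertTensor.induction {p : HilbertTensor H K → Prop} (z : HilbertTensor H K)
    (closed : IsClosed {z | p z}) (of : ∀ z, p (HilbertTensor.of z)) : p z :=
  UniformSpace.Completion.induction_on (α := H ⊗[ℂ] K) z closed of

/-- The operator `S ⊗ T` on the Hilbert space tensor product `H ⊗ K`. -/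
def opTensor (S : H →L[ℂ] H) (T : K →L[ℂ] K) : HilbertTensor H K →L[ℂ] HilbertTensor H K :=
  ((TensorProduct.mapL S T).completion :
    UniformSpace.Completion (H ⊗[ℂ] K) →L[ℂ] UniformSpace.Completion (H ⊗[ℂ] K))

lemma opTensor_of (S : H →L[ℂ] H) (T : K →L[ℂ] K) (z : H ⊗[ℂ] K) :
    opTensor S T (HilbertTensor.of z) = HilbertTensor.of (TensorProduct.mapL S T z) :=
  ContinuousLinearMap.completion_apply_coe _ _

lemma hilbertTensor_ext {f g : HilbertTensor H K →L[ℂ] HilbertTensor H K}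
    (h : ∀ z : H ⊗[ℂ] K, f (HilbertTensor.of z) = g (HilbertTensor.of z)) : f = g := by
  ext z
  induction z using HilbertTensor.induction with
  | closed => exact isClosed_eq f.continuous g.continuous
  | of z => exact h z

lemma opTensor_mul (S S' : H →L[ℂ] H) (T T' : K →L[ℂ] K) :
    opTensor (S * S') (T * T') = opTensor S T * opTensor S' T' :=
  hilbertTensor_ext fun z => by
    rw [mul_apply_eq_comp, opTensor_of, opTensor_of, opTensor_of,
      TensorProduct.mapL_mul, mul_apply_eq_comp]

lemma opTensor_one : opTensor (1 : H →L[ℂ] H) (1 : K →L[ℂ] K) = 1 :=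
  hilbertTensor_ext fun z => by
    rw [opTensor_of]
    exact congrArg _ (congrArg (fun f : (H ⊗[ℂ] K) →L[ℂ] (H ⊗[ℂ] K) => f z)
      TensorProduct.mapL_id_id)

lemma opTensor_add_left (S S' : H →L[ℂ] H) (T : K →L[ℂ] K) :
    opTensor (S + S') T = opTensor S T + opTensor S' T :=
  hilbertTensor_ext fun z => by
    rw [add_apply, opTensor_of, opTensor_of, opTensor_of,
      TensorProduct.mapL_add_left, add_apply, map_add]

lemma opTensor_add_right (S : H →L[ℂ] H) (T T' : K →L[ℂ] K) :
    opTensor S (T + T') = opTensor S T + opTensor S T' :=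
  hilbertTensor_ext fun z => by
    rw [add_apply, opTensor_of, opTensor_of, opTensor_of,
      TensorProduct.mapL_add_right, add_apply, map_add]

lemma opTensor_smul_left (c : ℂ) (S : H →L[ℂ] H) (T : K →L[ℂ] K) :
    opTensor (c • S) T = c • opTensor S T :=
  hilbertTensor_ext fun z => by
    rw [smul_apply, opTensor_of, opTensor_of,
      TensorProduct.mapL_smul_left, smul_apply,
      map_smul]

lemma opTensor_smul_right (c : ℂ) (S : H →L[ℂ] H) (T : K →L[ℂ] K) :
    opTensor S (c • T) = c • opTensor S T :=
  hilbertTensor_ext fun z => by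
    rw [smul_apply, opTensor_of, opTensor_of,
      TensorProduct.mapL_smul_right, smul_apply,
      map_smul]

lemma norm_opTensor_le (S : H →L[ℂ] H) (T : K →L[ℂ] K) : ‖opTensor S T‖ ≤ ‖S‖ * ‖T‖ := by
  refine ContinuousLinearMap.opNorm_le_bound _ (by positivity) fun z => ?_
  induction z using HilbertTensor.induction with
  | closed => exact isClosed_le (by fun_prop) (by fun_prop)
  | of z =>
    rw [opTensor_of, LinearIsometry.norm_map, LinearIsometry.norm_map]
    exact (ContinuousLinearMap.le_opNorm _ _).trans
      (mul_le_mul_of_nonneg_right (TensorProduct.norm_mapL_le S T) (norm_nonneg _))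

variable [CompleteSpace H] [CompleteSpace K]

lemma opTensor_star (S : H →L[ℂ] H) (T : K →L[ℂ] K) :
    opTensor (star S) (star T) = star (opTensor S T) := by
  refine (ContinuousLinearMap.eq_adjoint_iff _ _).mpr fun x y => ?_
  induction x using HilbertTensor.induction with
  | closed => exact isClosed_eq (by fun_prop) (by fun_prop)
  | of x =>
  induction y using HilbertTensor.induction with
  | closed => exact isClosed_eq (by fun_prop) (by fun_prop)
  | of y =>
    rw [opTensor_of, opTensor_of, LinearIsometry.inner_map_map, LinearIsometry.inner_map_map]
    induction x using TensorProduct.induction_on with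
    | zero => simp
    | add x x' hx hx' => rw [map_add, inner_add_left, inner_add_left, hx, hx']
    | tmul x x' =>
      induction y using TensorProduct.induction_on with
      | zero => simp
      | add y y' hy hy' => rw [map_add, inner_add_right, inner_add_right, hy, hy']
      | tmul y y' =>
        simp [ContinuousLinearMap.star_eq_adjoint, ContinuousLinearMap.adjoint_inner_left]

variable {A B : Type u} [CStarAlgebra A] [CStarAlgebra B]

/-- The tensor product `π ⊗ ρ` of two representations on Hilbert spaces, as a representation of the
algebraic tensor product on the Hilbert space tensor product. -/
def tensorRep (π : A →⋆ₐ[ℂ] (H →L[ℂ] H)) (ρ : B →⋆ₐ[ℂ] (K →L[ℂ] K)) :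
    A ⊗[ℂ] B →⋆ₐ[ℂ] (HilbertTensor H K →L[ℂ] HilbertTensor H K) :=
  let f : A →ₐ[ℂ] (HilbertTensor H K →L[ℂ] HilbertTensor H K) :=
    AlgHom.ofLinearMap
      { toFun := fun a => opTensor (π a) 1
        map_add' := fun a a' => by rw [map_add, opTensor_add_left]
        map_smul' := fun c a => by rw [map_smul, opTensor_smul_left, RingHom.id_apply] }
      (by simp [opTensor_one])
      (fun a a' => by
        change opTensor (π (a * a')) 1 = opTensor (π a) 1 * opTensor (π a') 1
        rw [← opTensor_mul, map_mul, mul_one])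
  let g : B →ₐ[ℂ] (HilbertTensor H K →L[ℂ] HilbertTensor H K) :=
    AlgHom.ofLinearMap
      { toFun := fun b => opTensor 1 (ρ b)
        map_add' := fun b b' => by rw [map_add, opTensor_add_right]
        map_smul' := fun c b => by rw [map_smul, opTensor_smul_right, RingHom.id_apply] }
      (by simp [opTensor_one])
      (fun b b' => by
        change opTensor 1 (ρ (b * b')) = opTensor 1 (ρ b) * opTensor 1 (ρ b')
        rw [← opTensor_mul, map_mul, mul_one])
  let h : A ⊗[ℂ] B →ₐ[ℂ] (HilbertTensor H K →L[ℂ] HilbertTensor H K) :=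
    Algebra.TensorProduct.lift f g fun a b => by
      change opTensor (π a) 1 * opTensor 1 (ρ b) = opTensor 1 (ρ b) * opTensor (π a) 1
      rw [← opTensor_mul, ← opTensor_mul, mul_one, one_mul, mul_one, one_mul]
  { h with
    map_star' := fun t => by
      have ht : ∀ a b, h (a ⊗ₜ[ℂ] b) = opTensor (π a) (ρ b) := fun a b => by
        rw [Algebra.TensorProduct.lift_tmul]
        change opTensor (π a) 1 * opTensor 1 (ρ b) = _
        rw [← opTensor_mul, mul_one, one_mul]
      change h (star t) = star (h t)
      induction t using TensorProduct.induction_on with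
      | zero => simp
      | add t t' h1 h2 => rw [star_add, map_add, map_add, star_add, h1, h2]
      | tmul a b =>
        rw [TensorProduct.star_tmul, ht, ht, ← opTensor_star, map_star, map_star] }

lemma tensorRep_tmul (π : A →⋆ₐ[ℂ] (H →L[ℂ] H)) (ρ : B →⋆ₐ[ℂ] (K →L[ℂ] K)) (a : A) (b : B) :
    tensorRep π ρ (a ⊗ₜ[ℂ] b) = opTensor (π a) (ρ b) := by
  change opTensor (π a) 1 * opTensor 1 (ρ b) = _
  rw [← opTensor_mul, mul_one, one_mul]

end MinTensor

section MinTensor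

variable (A B : Type u) [CStarAlgebra A] [CStarAlgebra B]

/-- The minimal (spatial) C⋆-norm on the algebraic tensor product of two C⋆-algebras:
`‖t‖ = sup ‖(π ⊗ ρ) t‖` over all pairs of representations on Hilbert spaces. -/
def minSeminorm : CStarSeminorm (A ⊗[ℂ] B) :=
  CStarSeminorm.sup
    {q | ∃ (H K : Type u) (_ : NormedAddCommGroup H) (_ : InnerProductSpace ℂ H)
      (_ : CompleteSpace H) (_ : NormedAddCommGroup K) (_ : InnerProductSpace ℂ K)
      (_ : CompleteSpace K) (π : A →⋆ₐ[ℂ] (H →L[ℂ] H)) (ρ : B →⋆ₐ[ℂ] (K →L[ℂ] K)),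
      q = CStarSeminorm.ofStarAlgHom (tensorRep π ρ)}
    (fun t => by
      induction t using TensorProduct.induction_on with
      | zero =>
        refine ⟨0, ?_⟩
        rintro _ ⟨H, K, _, _, _, _, _, _, π, ρ, rfl⟩
        exact (CStarSeminorm.map_zero _).le
      | add t t' ht ht' =>
        obtain ⟨C, hC⟩ := ht
        obtain ⟨D, hD⟩ := ht'
        exact ⟨C + D, fun q hq => (q.add_le t t').trans (add_le_add (hC q hq) (hD q hq))⟩
      | tmul a b =>
        refine ⟨‖a‖ * ‖b‖, ?_⟩
        rintro _ ⟨H, K, _, _, _, _, _, _, π, ρ, rfl⟩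
        change ‖tensorRep π ρ (a ⊗ₜ[ℂ] b)‖ ≤ _
        rw [tensorRep_tmul]
        exact (norm_opTensor_le _ _).trans (mul_le_mul (NonUnitalStarAlgHom.norm_apply_le π a)
          (NonUnitalStarAlgHom.norm_apply_le ρ b) (norm_nonneg _) (norm_nonneg _)))

/-- The minimal tensor product of two C⋆-algebras. -/
abbrev MinTensor : Type u := (minSeminorm A B).Completion

variable {A B}

/-- The elementary tensor `a ⊗ b` in the minimal tensor product. -/
def minTmul (a : A) (b : B) : MinTensor A B := (minSeminorm A B).toCompletion (a ⊗ₜ[ℂ] b)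

end MinTensor

/-! ### Two-coloured partitions -/

/-- A two-coloured partition with `k` upper and `l` lower points. The blocks are the classes of an
equivalence relation on the points. -/
structure TwoColouredPartition where
  k : ℕ
  l : ℕ
  upper : Fin k → Colour
  lower : Fin l → Colour
  blocks : Setoid (Fin k ⊕ Fin l)

namespace TwoColouredPartition

/-- The partition with a single block (or no block, if there are no points). -/
def oneBlock {k l : ℕ} (ω : Fin k → Colour) (ω' : Fin l → Colour) : TwoColouredPartition :=
  ⟨k, l, ω, ω', ⊤⟩

/-- The identity partition on one point of colour `c`. -/
def idPartition (c : Colour) : TwoColouredPartition := oneBlock ![c] ![c]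

/-- The pair partition on two lower points with colours `c`, `c'`. -/
def lowerPair (c c' : Colour) : TwoColouredPartition := oneBlock ![] ![c, c']

/-- The pair partition on two upper points with colours `c`, `c'`. -/
def upperPair (c c' : Colour) : TwoColouredPartition := oneBlock ![c, c'] ![]

/-- The four mixed-coloured pair partitions. -/
def mixedPairs : Set TwoColouredPartition :=
  {lowerPair .white .black, lowerPair .black .white, upperPair .white .black,
    upperPair .black .white}

/-- The tensor product: horizontal concatenation. -/
def tensor (p q : TwoColouredPartition) : TwoColouredPartition where
  k := p.k + q.k
  l := p.l + q.l
  upper := Fin.append p.upper q.upper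
  lower := Fin.append p.lower q.lower
  blocks := Setoid.comap
    (fun x : Fin (p.k + q.k) ⊕ Fin (p.l + q.l) =>
      Equiv.sumSumSumComm (Fin p.k) (Fin q.k) (Fin p.l) (Fin q.l)
        (Sum.map finSumFinEquiv.symm finSumFinEquiv.symm x))
    { r := Sum.LiftRel p.blocks.r q.blocks.r
      iseqv :=
        { refl := by rintro (a | a) <;> constructor <;> first | exact p.blocks.refl' _ | exact q.blocks.refl' _
          symm := by rintro _ _ (h | h) <;> constructor <;> first | exact p.blocks.symm' h | exact q.blocks.symm' h
          trans := by
            rintro _ _ _ (h | h) (h' | h') <;> constructor <;>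
              first | exact p.blocks.trans' h h' | exact q.blocks.trans' h h' } }

/-- The involution: reflection at the horizontal axis. -/
def involution (p : TwoColouredPartition) : TwoColouredPartition where
  k := p.l
  l := p.k
  upper := p.lower
  lower := p.upper
  blocks := Setoid.comap Sum.swap p.blocks

/-- Two points are linked in the vertical concatenation of `r` (above) and `s` (below) if they are
points of the same block of `r` or of the same block of `s`. -/
inductive Linked {k l m : ℕ} (r : Setoid (Fin k ⊕ Fin l)) (s : Setoid (Fin l ⊕ Fin m)) :
    Fin k ⊕ (Fin l ⊕ Fin m) → Fin k ⊕ (Fin l ⊕ Fin m) → Prop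
  | above {x y : Fin k ⊕ Fin l} (h : r x y) :
      Linked r s (Sum.map id Sum.inl x) (Sum.map id Sum.inl y)
  | below {x y : Fin l ⊕ Fin m} (h : s x y) : Linked r s (Sum.inr x) (Sum.inr y)

/-- The blocks of the composition: vertical concatenation of `r` (above) and `s` (below), after
which the `l` middle points are removed. -/
def compBlocks {k l m : ℕ} (r : Setoid (Fin k ⊕ Fin l)) (s : Setoid (Fin l ⊕ Fin m)) :
    Setoid (Fin k ⊕ Fin m) :=
  Setoid.comap (Sum.map id Sum.inr) (Relation.EqvGen.setoid (Linked r s))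

/-- A category of partitions: a set of partitions that contains the identity partitions and the
mixed-coloured pair partitions and is closed under tensor products, involution and composition
(of partitions with matching colours). -/
structure IsCategory (C : Set TwoColouredPartition) : Prop where
  id_mem : ∀ c, idPartition c ∈ C
  mixedPairs_subset : mixedPairs ⊆ C
  tensor_mem : ∀ p ∈ C, ∀ q ∈ C, tensor p q ∈ C
  involution_mem : ∀ p ∈ C, involution p ∈ C
  comp_mem : ∀ {k l m : ℕ} (ω : Fin k → Colour) (ω' : Fin l → Colour) (ω'' : Fin m → Colour)
    (r : Setoid (Fin k ⊕ Fin l)) (s : Setoid (Fin l ⊕ Fin m)),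
    ⟨k, l, ω, ω', r⟩ ∈ C → ⟨l, m, ω', ω'', s⟩ ∈ C → ⟨k, m, ω, ω'', compBlocks r s⟩ ∈ C

/-- The category of partitions `⟨P⟩` generated by a set `P` of partitions. -/
def generatedCategory (P : Set TwoColouredPartition) : Set TwoColouredPartition :=
  ⋂₀ {C | IsCategory C ∧ P ⊆ C}

/-! ### Labelings -/

variable (p : TwoColouredPartition)

/-- The through-blocks: blocks containing both upper and lower points. -/
def ThroughBlock : Type :=
  {b : Quotient p.blocks // (∃ a, Quotient.mk p.blocks (Sum.inl a) = b) ∧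
    ∃ a, Quotient.mk p.blocks (Sum.inr a) = b}

/-- Valid labelings of the upper row: connected upper points have equal labels. -/
def ValidUpper {N : ℕ} (t : Fin p.k → Fin N) : Prop :=
  ∀ a b, p.blocks (Sum.inl a) (Sum.inl b) → t a = t b

/-- Valid labelings of the lower row: connected lower points have equal labels. -/
def ValidLower {N : ℕ} (t : Fin p.l → Fin N) : Prop :=
  ∀ a b, p.blocks (Sum.inr a) (Sum.inr b) → t a = t b

/-- The set `T_i` of all valid labelings of the upper row with through-block labeling `i`. The
index set `{1, …, r}` with `r = N ^ tb(p)` is realised as the set of all labelings of the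
through-blocks. -/
def upperClass {N : ℕ} (i : p.ThroughBlock → Fin N) : Set (Fin p.k → Fin N) :=
  {t | p.ValidUpper t ∧
    ∀ (b : p.ThroughBlock) (a : Fin p.k), Quotient.mk p.blocks (Sum.inl a) = b.1 → t a = i b}

/-- The set `T'_i` of all valid labelings of the lower row with through-block labeling `i`. -/
def lowerClass {N : ℕ} (i : p.ThroughBlock → Fin N) : Set (Fin p.l → Fin N) :=
  {t | p.ValidLower t ∧
    ∀ (b : p.ThroughBlock) (a : Fin p.l), Quotient.mk p.blocks (Sum.inr a) = b.1 → t a = i b}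

/-! ### Quantum space relations -/

variable {N d : ℕ} {A : Type u} [Ring A] [StarRing A]

open Classical in
/-- `∑_{t ∈ T_i} x_{t₁γ₁}^{ω₁} ⋯ x_{t_kγ_k}^{ω_k}`. -/
def upperSum (x : Fin N → Fin d → A) (i : p.ThroughBlock → Fin N) (γ : Fin p.k → Fin d) : A :=
  ∑ t : Fin p.k → Fin N with t ∈ p.upperClass i,
    (List.ofFn fun a => (p.upper a).pow (x (t a) (γ a))).prod

open Classical in
/-- `∑_{t' ∈ T'_i} x_{t'₁γ'₁}^{ω'₁} ⋯ x_{t'_lγ'_l}^{ω'_l}`. -/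
def lowerSum (x : Fin N → Fin d → A) (i : p.ThroughBlock → Fin N) (γ : Fin p.l → Fin d) : A :=
  ∑ t : Fin p.l → Fin N with t ∈ p.lowerClass i,
    (List.ofFn fun a => (p.lower a).pow (x (t a) (γ a))).prod

/-- The quantum space relations `R^{Sp}_p(x)` of a partition `p` for a tuple `x` of `d ≤ N` vectors
of length `N`; the set `[d]` is regarded as a subset of `[N]`. -/
structure SpaceRelations (hd : d ≤ N) (x : Fin N → Fin d → A) : Prop where
  valid : ∀ (i j : p.ThroughBlock → Fin N) (γ : Fin p.k → Fin d) (γ' : Fin p.l → Fin d),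
    (fun a => Fin.castLE hd (γ a)) ∈ p.upperClass j →
    (fun a => Fin.castLE hd (γ' a)) ∈ p.lowerClass j →
    p.upperSum x i γ = p.lowerSum x i γ'
  upper_invalid : ∀ (i : p.ThroughBlock → Fin N) (γ : Fin p.k → Fin d),
    ¬ p.ValidUpper (fun a => Fin.castLE hd (γ a)) → p.upperSum x i γ = 0
  lower_invalid : ∀ (i : p.ThroughBlock → Fin N) (γ' : Fin p.l → Fin d),
    ¬ p.ValidLower (fun a => Fin.castLE hd (γ' a)) → p.lowerSum x i γ' = 0

end TwoColouredPartition

open TwoColouredPartition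

/-- The relations for the pair partition with lower colours white, black bound the generators. -/
lemma norm_le_one_of_spaceRelations {N d : ℕ} (hd : d ≤ N) {B : Type u} [CStarAlgebra B]
    (x : Fin N → Fin d → B) (h : (lowerPair .white .black).SpaceRelations hd x)
    (i : Fin N) (j : Fin d) : ‖x i j‖ ≤ 1 := by
  have hE : ∀ b : (lowerPair .white .black).ThroughBlock, False := by
    rintro ⟨b, ⟨a, _⟩, _⟩
    exact a.elim0
  have h1 := h.valid (fun b => (hE b).elim) (fun b => (hE b).elim) (fun a => a.elim0) (fun _ => j)
    ⟨fun a => a.elim0, fun b => (hE b).elim⟩ ⟨fun _ _ _ => rfl, fun b => (hE b).elim⟩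
  have h2 : upperSum (lowerPair .white .black) x (fun b => (hE b).elim) (fun a => a.elim0) = 1 := by
    classical
    unfold upperSum
    rw [Finset.sum_eq_single_of_mem (fun a => a.elim0)]
    · simp [lowerPair, oneBlock]
    · simp only [Finset.mem_filter, Finset.mem_univ, true_and]
      exact ⟨fun a => a.elim0, fun b => (hE b).elim⟩
    · intro t _ ht
      exact (ht (funext fun a => a.elim0)).elim
  have h3 : lowerSum (lowerPair .white .black) x (fun b => (hE b).elim) (fun _ => j) =
      ∑ t, x t j * star (x t j) := by
    classical
    unfold lowerSum
    symm
    refine Finset.sum_bij (fun t _ _ => t) ?_ ?_ ?_ ?_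
    · intro t _
      simp only [Finset.mem_filter, Finset.mem_univ, true_and]
      exact ⟨fun _ _ _ => rfl, fun b => (hE b).elim⟩
    · intro t _ t' _ h
      exact congrFun h (0 : Fin 2)
    · intro t ht
      simp only [Finset.mem_filter, Finset.mem_univ, true_and] at ht
      exact ⟨t (0 : Fin 2), Finset.mem_univ _, funext fun a => ht.1 _ _ trivial⟩
    · intro t _
      simp [lowerPair, oneBlock, Colour.pow, List.ofFn_succ]
  rw [h2, h3] at h1
  let _ := CStarAlgebra.spectralOrder B
  have := CStarAlgebra.spectralOrderedRing B
  have h4 : x i j * star (x i j) ≤ 1 := by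
    rw [h1]
    exact Finset.single_le_sum (f := fun t => x t j * star (x t j))
      (fun t _ => mul_star_self_nonneg _) (Finset.mem_univ i)
  have h5 := CStarAlgebra.norm_le_norm_of_nonneg_of_le (mul_star_self_nonneg _) h4
  rw [CStarRing.norm_self_mul_star] at h5
  have h6 : ‖(1 : B)‖ ≤ 1 := by
    rcases subsingleton_or_nontrivial B with hB | hB
    · rw [Subsingleton.elim (1 : B) 0]; simp
    · simp
  nlinarith [norm_nonneg (x i j)]

/-! ### Partition quantum spaces -/

section PQS

variable (N d : ℕ) (hd : d ≤ N) (P : Set TwoColouredPartition) (hP : mixedPairs ⊆ P)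

/-- The relations `R^{Sp}_p(x)`, `p ∈ P`, on generators `x_{ij}` with `i ∈ [N]`, `j ∈ [d]`. -/
def pqsRelations : CStarRelations.{u} (ULift.{u} (Fin N × Fin d)) where
  Holds _ _ y := ∀ p ∈ P, p.SpaceRelations hd fun i j => y ⟨(i, j)⟩
  bounded x := ⟨1, fun _ _ y hy => norm_le_one_of_spaceRelations hd (fun i j => y ⟨(i, j)⟩)
    (hy _ (hP (by simp [mixedPairs]))) x.down.1 x.down.2⟩

/-- The C⋆-algebra `C(X_{N,d}(P))` of the partition quantum space `X_{N,d}(P)` of `d` vectors. -/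
abbrev PQS : Type u := (pqsRelations.{u} N d hd P hP).Universal

/-- The generators `x_{ij}` of `C(X_{N,d}(P))`. -/
def pqsGen (i : Fin N) (j : Fin d) : PQS.{u} N d hd P hP :=
  (pqsRelations.{u} N d hd P hP).gen ⟨(i, j)⟩

end PQS

/-! ### Compact matrix quantum groups and quantum symmetry groups -/

/-- A compact matrix quantum group `G`, given by the unital C⋆-algebra `C(G)` and its matrix `u`. -/
structure CMQG (N : ℕ) where
  /-- The C⋆-algebra `C(G)`. -/
  carrier : Type u
  [cstar : CStarAlgebra carrier]
  /-- The matrix of generators. -/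
  u : Matrix (Fin N) (Fin N) carrier
  generates : (StarAlgebra.adjoin ℂ
    (Set.range fun ij : Fin N × Fin N => u ij.1 ij.2)).topologicalClosure = ⊤
  isUnit : IsUnit u
  isUnit_conj : IsUnit (u.map star)
  exists_comul : ∃ Δ : carrier →⋆ₐ[ℂ] MinTensor carrier carrier,
    ∀ i j, Δ (u i j) = ∑ k, minTmul (u i k) (u k j)

attribute [instance] CMQG.cstar

namespace CMQG

variable {N d : ℕ}

/-- `G.IsSubgroup G'` means `G ⊆ G'`: there is a ⋆-homomorphism `C(G') → C(G)` mapping the entries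
of the matrix of `G'` to those of the matrix of `G`. -/
def IsSubgroup (G G' : CMQG.{u} N) : Prop :=
  ∃ φ : G'.carrier →⋆ₐ[ℂ] G.carrier, ∀ i j, φ (G'.u i j) = G.u i j

/-- `G` and `G'` are equal as compact matrix quantum groups: there is a ⋆-isomorphism
`C(G) ≅ C(G')` identifying the matrices of generators. -/
def Same (G G' : CMQG.{u} N) : Prop :=
  ∃ φ : G.carrier ≃⋆ₐ[ℂ] G'.carrier, ∀ i j, φ (G.u i j) = G'.u i j

variable {B : Type u} [CStarAlgebra B]

/-- Left and right matrix-vector actions of `G` on the quantum space with algebra `B` and the `d`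
vectors `x` of generators. -/
structure HasActions (G : CMQG.{u} N) (x : Fin N → Fin d → B) : Prop where
  left : ∃ α : B →⋆ₐ[ℂ] MinTensor G.carrier B, ∀ i j, α (x i j) = ∑ k, minTmul (G.u i k) (x k j)
  right : ∃ β : B →⋆ₐ[ℂ] MinTensor G.carrier B, ∀ i j, β (x i j) = ∑ k, minTmul (G.u k i) (x k j)

/-- `G` is the quantum symmetry group of the quantum space of vectors `(B, x)`: it is the maximal
compact matrix quantum group with left and right matrix-vector actions on it. -/
structure IsQuantumSymmetryGroup (G : CMQG.{u} N) (x : Fin N → Fin d → B) : Prop where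
  hasActions : G.HasActions x
  maximal : ∀ G' : CMQG.{u} N, G'.HasActions x → G'.IsSubgroup G

end CMQG

end

/-! The relations `R^{Sp}_p(x)` say that a single matrix `M`, indexed by the labelings of the
through-blocks, satisfies `U * W = M * U` and `L * W' = M * L`. Here `U` and `L` are the `0`-`1`
matrices recording which labelings of the upper and of the lower row restrict to a given labeling of
the through-blocks, and `W`, `W'` are the tensor powers of `x` coloured by the upper and the lower
word. Hence the unit matrix is a solution, and products of solutions with commuting entries are
solutions.

Imposed on both `x` and its transpose, the relations of `p` become the statement that
`T_p = Uᵀ * L` and its transpose intertwine `W` and `W'`. The partitions with this property form a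
category, so `x` and its transpose satisfy the relations of all `p ∈ P` if and only if they satisfy
those of all `p ∈ ⟨P⟩`.

As the unit matrix is a classical point of `X_{N,N}(P)`, a compact matrix quantum group acts on
`X_{N,N}(P)` from the left if and only if its matrix `u` satisfies the relations of `P`, and from
the right if and only if `uᵀ` does. The universal such `u` therefore defines the quantum symmetry
group, and it depends on `⟨P⟩` only. -/

noncomputable section

open TwoColouredPartition

/-! ### Universal C⋆-algebras -/

namespace CStarSeminorm

section

variable {A : Type u} [Ring A] [StarRing A] [Algebra ℂ A]

lemma le_sup {S : Set (CStarSeminorm A)} (hS : ∀ a, ∃ C, ∀ q ∈ S, q.toFun a ≤ C)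
    {q : CStarSeminorm A} (hq : q ∈ S) (a : A) : q.toFun a ≤ (sup S hS).toFun a := by
  obtain ⟨C, hC⟩ := hS a
  have hbdd : BddAbove (Set.range fun q : S => q.1.toFun a) :=
    ⟨C, by rintro _ ⟨q, rfl⟩; exact hC q.1 q.2⟩
  exact le_ciSup hbdd ⟨q, hq⟩

lemma sup_eq_zero {S : Set (CStarSeminorm A)} (hS : ∀ a, ∃ C, ∀ q ∈ S, q.toFun a ≤ C)
    {a : A} (h : ∀ q ∈ S, q.toFun a = 0) : (sup S hS).toFun a = 0 :=
  le_antisymm (Real.iSup_le (fun q => (h q.1 q.2).le) le_rfl) ((sup S hS).nonneg a)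

end

variable {A : Type u} [Ring A] [StarRing A] [Algebra ℂ A] [StarModule ℂ A] (q : CStarSeminorm A)

lemma norm_toCompletion (a : A) : ‖q.toCompletion a‖ = q.toFun a :=
  UniformSpace.Completion.norm_coe (E := q.Pre) a

lemma denseRange_toCompletion : DenseRange q.toCompletion :=
  UniformSpace.Completion.denseRange_coe (α := q.Pre)

lemma exists_lift {B : Type v} [CStarAlgebra B] (π : A →⋆ₐ[ℂ] B) (hπ : ∀ a, ‖π a‖ ≤ q.toFun a) :
    ∃ φ : q.Completion →⋆ₐ[ℂ] B, ∀ a, φ (q.toCompletion a) = π a := by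
  let f : q.Pre →+* B := (π : A →+* B)
  have hf : Continuous f := AddMonoidHomClass.continuous_of_bound f 1 fun a => by
    rw [one_mul]; exact hπ a
  let g : q.Completion →+* B := UniformSpace.Completion.extensionHom f hf
  have hg (a : A) : g (q.toCompletion a) = π a := UniformSpace.Completion.extensionHom_coe f hf a
  have hg_cont : Continuous g := UniformSpace.Completion.continuous_extension
  have hg_scalar (c : ℂ) : g (algebraMap ℂ q.Completion c) = algebraMap ℂ B c := by
    rw [← AlgHomClass.commutes q.toCompletion, hg, AlgHomClass.commutes]
  have hg_star (x : q.Completion) : g (star x) = star (g x) := by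
    refine q.denseRange_toCompletion.induction_on x
      (isClosed_eq (hg_cont.comp continuous_star) (continuous_star.comp hg_cont)) fun a => ?_
    rw [← StarHomClass.map_star, hg, hg, StarHomClass.map_star]
  exact ⟨{ g with commutes' := hg_scalar, map_star' := hg_star }, hg⟩

end CStarSeminorm

namespace FreeStarAlgebra

variable {X : Type u}

lemma star_of (x : X) : star (of x) = letter x .black := by
  rw [star_def, of, starHom_letter]; rfl

lemma eval_of {B : Type v} [Ring B] [StarRing B] [Algebra ℂ B] [StarModule ℂ B] (y : X → B)
    (x : X) : eval y (of x) = y x := eval_letter y x .white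

end FreeStarAlgebra

namespace CStarRelations

variable {X : Type u} (R : CStarRelations X)

lemma exists_lift {B : Type u} [CStarAlgebra B] {y : X → B} (hy : R.Holds B y) :
    ∃ φ : R.Universal →⋆ₐ[ℂ] B, ∀ x, φ (R.gen x) = y x := by
  obtain ⟨φ, hφ⟩ := R.universalSeminorm.exists_lift (FreeStarAlgebra.eval y)
    (CStarSeminorm.le_sup (q := .ofStarAlgHom (FreeStarAlgebra.eval y)) _ ⟨B, _, y, hy, rfl⟩)
  exact ⟨φ, fun x => by rw [gen, hφ, FreeStarAlgebra.eval_of]⟩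

lemma toCompletion_eq_zero {a : FreeStarAlgebra X}
    (ha : ∀ (B : Type u) [CStarAlgebra B] (y : X → B), R.Holds B y →
      FreeStarAlgebra.eval y a = 0) :
    R.universalSeminorm.toCompletion a = 0 := by
  rw [← norm_eq_zero, CStarSeminorm.norm_toCompletion]
  refine CStarSeminorm.sup_eq_zero _ ?_
  rintro _ ⟨B, _, y, hy, rfl⟩
  exact norm_eq_zero.2 (ha B y hy)

lemma toCompletion_mem_adjoin_gen (a : FreeStarAlgebra X) :
    R.universalSeminorm.toCompletion a ∈ StarAlgebra.adjoin ℂ (Set.range R.gen) := by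
  have hgen (x : X) : R.gen x ∈ StarAlgebra.adjoin ℂ (Set.range R.gen) :=
    StarAlgebra.subset_adjoin ℂ _ ⟨x, rfl⟩
  induction a using FreeStarAlgebra.induction with
  | algebraMap r => rw [AlgHomClass.commutes]; exact algebraMap_mem _ r
  | letter x c =>
    cases c with
    | white => exact hgen x
    | black => rw [← FreeStarAlgebra.star_of, map_star]; exact star_mem (hgen x)
  | mul a b ha hb => rw [map_mul]; exact mul_mem ha hb
  | add a b ha hb => rw [map_add]; exact add_mem ha hb

lemma adjoin_gen_topologicalClosure :
    (StarAlgebra.adjoin ℂ (Set.range R.gen)).topologicalClosure = ⊤ :=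
  eq_top_iff.2 fun z _ => R.universalSeminorm.denseRange_toCompletion.induction_on z
    (StarSubalgebra.isClosed_topologicalClosure _) fun a =>
      StarSubalgebra.le_topologicalClosure _ (R.toCompletion_mem_adjoin_gen a)

end CStarRelations

/-! ### Representations and minimal tensor products -/

open scoped CStarAlgebra in
lemma starAlgHom_eq_of_eqOn_generators {A B : Type*} [CStarAlgebra A] [CStarAlgebra B] {s : Set A}
    (hs : (StarAlgebra.adjoin ℂ s).topologicalClosure = ⊤) {φ ψ : A →⋆ₐ[ℂ] B}
    (h : Set.EqOn φ ψ s) : φ = ψ := by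
  have hclosed : IsClosed (StarAlgHom.equalizer φ ψ : Set A) :=
    isClosed_eq (map_continuous φ) (map_continuous ψ)
  have htop := StarSubalgebra.topologicalClosure_minimal (StarAlgebra.adjoin_le h) hclosed
  rw [hs] at htop
  exact StarAlgHom.ext fun a => htop (StarSubalgebra.mem_top (R := ℂ) (x := a))

section Representations

variable {A : Type u} [CStarAlgebra A]

/-- The complex-linear extension of the restriction of a real functional on a C⋆-algebra to the
self-adjoint elements. -/
def complexify (g : A →ₗ[ℝ] ℝ) : A →ₗ[ℂ] ℂ where
  toFun a := (g (realPart a : A) : ℂ) + Complex.I * (g (imaginaryPart a : A) : ℂ)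
  map_add' a b := by
    simp only [map_add, AddSubgroup.coe_add, Complex.ofReal_add]
    ring
  map_smul' c a := by
    rw [realPart_smul, imaginaryPart_smul]
    apply Complex.ext <;> simp

lemma complexify_of_isSelfAdjoint (g : A →ₗ[ℝ] ℝ) {a : A} (ha : IsSelfAdjoint a) :
    complexify g a = g a := by
  simp [complexify, ha.coe_realPart, ha.imaginaryPart]

section

variable [PartialOrder A] [StarOrderedRing A]

lemma exists_positiveLinearMap_star_mul_self_ne_zero {a : A} (ha : a ≠ 0) :
    ∃ f : A →ₚ[ℂ] ℂ, f (star a * a) ≠ 0 := by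
  let C : ProperCone ℝ A :=
    { carrier := {a | 0 ≤ a}
      add_mem' := fun {a b} (ha : 0 ≤ a) (hb : 0 ≤ b) => add_nonneg ha hb
      zero_mem' := le_refl (0 : A)
      smul_mem' := fun c a (ha : 0 ≤ a) => smul_nonneg c.2 ha
      isClosed' := CStarAlgebra.isClosed_nonneg }
  have hnot_mem : -(star a * a) ∉ C := fun h => by
    have hzero : star a * a = 0 := le_antisymm (neg_nonneg.1 h) (star_mul_self_nonneg a)
    exact ha ((CStarRing.star_mul_self_eq_zero_iff a).1 hzero)
  obtain ⟨g, hg, hg_neg⟩ := C.hyperplane_separation_point hnot_mem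
  refine ⟨.mk₀ (complexify (g : A →ₗ[ℝ] ℝ)) fun x hx => ?_, fun hzero => ?_⟩
  · rw [complexify_of_isSelfAdjoint _ (IsSelfAdjoint.of_nonneg hx)]
    exact Complex.zero_le_real.2 (hg x hx)
  · have hg_zero : g (star a * a) = 0 := by
      have h := complexify_of_isSelfAdjoint (g : A →ₗ[ℝ] ℝ) (IsSelfAdjoint.star_mul_self a)
      exact Complex.ofReal_eq_zero.1 (h.symm.trans hzero)
    rw [map_neg, hg_zero, neg_zero] at hg_neg
    exact hg_neg.false

lemma gnsStarAlgHom_ne_zero {f : A →ₚ[ℂ] ℂ} {a : A} (ha : f (star a * a) ≠ 0) :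
    f.gnsStarAlgHom a ≠ 0 := fun h => ha <| by
  have hvector : ((f.toPreGNS (a * 1) : f.PreGNS) : f.GNS) = 0 := by
    rw [← PositiveLinearMap.ofPreGNS_toPreGNS f 1, ← PositiveLinearMap.leftMulMapPreGNS_apply,
      ← PositiveLinearMap.gnsNonUnitalStarAlgHom_apply_coe]
    exact congrArg (fun T : f.GNS →L[ℂ] f.GNS => T (f.toPreGNS 1 : f.PreGNS)) h
  have hnorm := f.preGNS_norm_sq (f.toPreGNS (a * 1))
  rw [← UniformSpace.Completion.norm_coe, hvector, norm_zero] at hnorm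
  simpa using hnorm.symm

end

theorem exists_representation_ne_zero {a : A} (ha : a ≠ 0) :
    ∃ (H : Type u) (_ : NormedAddCommGroup H) (_ : InnerProductSpace ℂ H) (_ : CompleteSpace H)
      (π : A →⋆ₐ[ℂ] (H →L[ℂ] H)), π a ≠ 0 := by
  let _ := CStarAlgebra.spectralOrder A
  have := CStarAlgebra.spectralOrderedRing A
  obtain ⟨f, hf⟩ := exists_positiveLinearMap_star_mul_self_ne_zero ha
  exact ⟨f.GNS, inferInstance, inferInstance, inferInstance, f.gnsStarAlgHom,
    gnsStarAlgHom_ne_zero hf⟩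

end Representations

section MinTensor

variable {A B : Type u} [CStarAlgebra A] [CStarAlgebra B]

/-- The embedding `a ↦ a ⊗ 1` into the minimal tensor product. -/
def minTensorLeft : A →⋆ₐ[ℂ] MinTensor A B :=
  (minSeminorm A B).toCompletion.comp
    { (Algebra.TensorProduct.includeLeft : A →ₐ[ℂ] A ⊗[ℂ] B) with
      map_star' := fun a => by
        change star a ⊗ₜ[ℂ] (1 : B) = star (a ⊗ₜ[ℂ] (1 : B))
        rw [TensorProduct.star_tmul, star_one] }

/-- The embedding `b ↦ 1 ⊗ b` into the minimal tensor product. -/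
def minTensorRight : B →⋆ₐ[ℂ] MinTensor A B :=
  (minSeminorm A B).toCompletion.comp
    { (Algebra.TensorProduct.includeRight : B →ₐ[ℂ] A ⊗[ℂ] B) with
      map_star' := fun b => by
        change (1 : A) ⊗ₜ[ℂ] star b = star ((1 : A) ⊗ₜ[ℂ] b)
        rw [TensorProduct.star_tmul, star_one] }

lemma minTmul_mul_minTmul (a a' : A) (b b' : B) :
    minTmul a b * minTmul a' b' = minTmul (a * a') (b * b') := by
  rw [minTmul, minTmul, ← map_mul, Algebra.TensorProduct.tmul_mul_tmul, minTmul]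

lemma minTensorLeft_mul_minTensorRight (a : A) (b : B) :
    minTensorLeft a * minTensorRight b = minTmul a b := by
  change minTmul a 1 * minTmul 1 b = _
  rw [minTmul_mul_minTmul, mul_one, one_mul]

lemma commute_minTensorLeft_minTensorRight (a : A) (b : B) :
    Commute (minTensorLeft (B := B) a) (minTensorRight b) := by
  rw [commute_iff_eq, minTensorLeft_mul_minTensorRight]
  change _ = minTmul 1 b * minTmul a 1
  rw [minTmul_mul_minTmul, mul_one, one_mul]

lemma exists_tensorRep_lift {H K : Type u} [NormedAddCommGroup H] [InnerProductSpace ℂ H]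
    [CompleteSpace H] [NormedAddCommGroup K] [InnerProductSpace ℂ K] [CompleteSpace K]
    (π : A →⋆ₐ[ℂ] (H →L[ℂ] H)) (ρ : B →⋆ₐ[ℂ] (K →L[ℂ] K)) :
    ∃ φ : MinTensor A B →⋆ₐ[ℂ] (HilbertTensor H K →L[ℂ] HilbertTensor H K),
      ∀ a b, φ (minTmul a b) = opTensor (π a) (ρ b) := by
  obtain ⟨φ, hφ⟩ := (minSeminorm A B).exists_lift (tensorRep π ρ)
    (CStarSeminorm.le_sup (q := .ofStarAlgHom (tensorRep π ρ)) _
      ⟨H, K, _, _, _, _, _, _, π, ρ, rfl⟩)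
  exact ⟨φ, fun a b => by rw [minTmul, hφ, tensorRep_tmul]⟩

lemma eq_zero_of_opTensor_one_eq_zero {H K : Type u} [NormedAddCommGroup H]
    [InnerProductSpace ℂ H] [NormedAddCommGroup K] [InnerProductSpace ℂ K] [Nontrivial K]
    {S : H →L[ℂ] H} (hS : opTensor S (1 : K →L[ℂ] K) = 0) : S = 0 := by
  obtain ⟨y, hy⟩ := exists_ne (0 : K)
  ext x
  have h := congrArg (fun T : HilbertTensor H K →L[ℂ] HilbertTensor H K =>
    ‖T (HilbertTensor.of (x ⊗ₜ[ℂ] y))‖) hS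
  simpa [opTensor_of, hy] using h

end MinTensor

/-! ### Intertwining indicator matrices -/

open scoped Matrix Kronecker

section Matrices

variable {A ι κ m n o q : Type*}

lemma kronecker_mul_kronecker_of_commute [Semiring A] [Fintype m] [Fintype o]
    {M : Matrix ι m A} {M' : Matrix m n A} {L : Matrix κ o A} {L' : Matrix o q A}
    (h : ∀ i j i' j', Commute (L i j) (M' i' j')) :
    (M ⊗ₖ L) * (M' ⊗ₖ L') = (M * M') ⊗ₖ (L * L') := by
  ext ⟨i, k⟩ ⟨j, l⟩
  simp only [Matrix.mul_apply, Matrix.kroneckerMap_apply, Fintype.sum_prod_type,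
    Finset.sum_mul_sum]
  exact Finset.sum_congr rfl fun a _ => Finset.sum_congr rfl fun b _ =>
    (h k b a j).mul_mul_mul_comm _ _

open Classical in
/-- The matrix with entries `0` and `1` whose entries `1` are at the related pairs. -/
def indicatorMatrix (A : Type*) [Zero A] [One A] (R : m → n → Prop) : Matrix m n A :=
  .of fun i j => if R i j then 1 else 0

lemma indicatorMatrix_apply [Zero A] [One A] (R : m → n → Prop) [∀ i j, Decidable (R i j)]
    (i : m) (j : n) : indicatorMatrix A R i j = if R i j then 1 else 0 := by
  simp only [indicatorMatrix, Matrix.of_apply]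
  congr

lemma indicatorMatrix_eq [Zero A] [One A] [DecidableEq m] :
    indicatorMatrix A (Eq : m → m → Prop) = 1 := by
  ext i j
  rw [indicatorMatrix_apply, Matrix.one_apply]

lemma transpose_indicatorMatrix [Zero A] [One A] (R : m → n → Prop) :
    (indicatorMatrix A R)ᵀ = indicatorMatrix A (flip R) := rfl

lemma indicatorMatrix_kronecker [MulZeroOneClass A] (R : m → n → Prop) (S : o → q → Prop) :
    indicatorMatrix A R ⊗ₖ indicatorMatrix A S =
      indicatorMatrix A fun i j => R i.1 j.1 ∧ S i.2 j.2 := by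
  classical
  ext i j
  simp only [Matrix.kroneckerMap_apply, indicatorMatrix_apply, ite_and, mul_ite, mul_one, mul_zero]
  split_ifs <;> rfl

variable [Semiring A]

lemma commute_indicatorMatrix (R : m → n → Prop) (i : m) (j : n) (a : A) :
    Commute (indicatorMatrix A R i j) a := by
  classical
  rw [indicatorMatrix_apply]
  split_ifs
  exacts [Commute.one_left a, Commute.zero_left a]

lemma indicatorMatrix_mul_apply [Fintype n] (R : m → n → Prop) [∀ i j, Decidable (R i j)]
    (M : Matrix n o A) (i : m) (j : o) :
    (indicatorMatrix A R * M) i j = ∑ k with R i k, M k j := by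
  simp only [Matrix.mul_apply, indicatorMatrix_apply, ite_mul, one_mul, zero_mul, Finset.sum_filter]

lemma transpose_indicatorMatrix_mul [Fintype n] (R : m → n → Prop) (M : Matrix n o A) :
    (indicatorMatrix A R * M)ᵀ = Mᵀ * (indicatorMatrix A R)ᵀ := by
  ext i j
  exact Finset.sum_congr rfl fun k _ => commute_indicatorMatrix R j k (M k i)

lemma eq_mul_indicatorMatrix_iff [Fintype ι] {R : ι → n → Prop}
    (hR : ∀ i j t, R i t → R j t → i = j) {X : Matrix m n A} {M : Matrix m ι A} :
    X = M * indicatorMatrix A R ↔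
      (∀ i j t, R j t → X i t = M i j) ∧ ∀ i t, (∀ j, ¬ R j t) → X i t = 0 := by
  classical
  have hrelated {i j t} (h : R j t) : (M * indicatorMatrix A R) i t = M i j := by
    rw [Matrix.mul_apply, Finset.sum_eq_single j _ (by simp), indicatorMatrix_apply, if_pos h,
      mul_one]
    intro j' _ hj'
    rw [indicatorMatrix_apply, if_neg fun h' => hj' (hR _ _ _ h' h), mul_zero]
  have hunrelated {i t} (h : ∀ j, ¬ R j t) : (M * indicatorMatrix A R) i t = 0 :=
    Finset.sum_eq_zero fun j _ => by
      beta_reduce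
      rw [indicatorMatrix_apply, if_neg (h j), mul_zero]
  constructor
  · rintro rfl
    exact ⟨fun i j t => hrelated, fun i t => hunrelated⟩
  · rintro ⟨h, h'⟩
    ext i t
    by_cases ht : ∃ j, R j t
    · obtain ⟨j, hj⟩ := ht
      rw [h i j t hj, hrelated hj]
    · rw [h' i t (not_exists.1 ht), hunrelated (not_exists.1 ht)]

lemma transpose_mul_indicatorMatrix [Fintype n] (M : Matrix m n A) (R : n → o → Prop) :
    (M * indicatorMatrix A R)ᵀ = (indicatorMatrix A R)ᵀ * Mᵀ := by
  ext i j
  exact Finset.sum_congr rfl fun k _ => (commute_indicatorMatrix R k i (M j k)).symm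

lemma indicatorMatrix_mul_transpose_eq_iff [Fintype m] [Fintype n] {R : m → n → Prop}
    {V : Matrix n n A} {M : Matrix m m A} :
    indicatorMatrix A R * Vᵀ = M * indicatorMatrix A R ↔
      V * (indicatorMatrix A R)ᵀ = (indicatorMatrix A R)ᵀ * Mᵀ := by
  rw [← Matrix.transpose_inj, transpose_indicatorMatrix_mul, transpose_mul_indicatorMatrix,
    Matrix.transpose_transpose]

/-- A relation between two additive groups that is a subgroup of their product. -/
structure IsAdditiveRel [AddGroup m] [AddGroup n] (R : m → n → Prop) : Prop where
  zero : R 0 0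
  sub {i i' : m} {j j' : n} : R i j → R i' j' → R (i - i') (j - j')

namespace IsAdditiveRel

section AddGroup

variable [AddGroup m] [AddGroup n] {R : m → n → Prop}

lemma add (hR : IsAdditiveRel R) {i i' : m} {j j' : n} (h : R i j) (h' : R i' j') :
    R (i + i') (j + j') := by
  simpa using hR.sub h (hR.sub hR.zero h')

lemma flip (hR : IsAdditiveRel R) : IsAdditiveRel (flip R) :=
  ⟨hR.zero, fun h h' => hR.sub h h'⟩

end AddGroup

variable [AddGroup m] [AddGroup n] [AddGroup o] {R : m → n → Prop} {S : n → o → Prop}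

-- The relations being subgroups, the nonempty fibres of `(i, k, j) ↦ (i, j)` on
-- `{(i, k, j) | R i k ∧ S k j}` are cosets of the fibre over `(0, 0)`.
lemma exists_indicatorMatrix_mul (𝕜 : Type*) [Semiring 𝕜] [CharZero 𝕜] [Module 𝕜 A] [Fintype n]
    (hR : IsAdditiveRel R) (hS : IsAdditiveRel S) :
    ∃ c : 𝕜, c ≠ 0 ∧ (indicatorMatrix A R * indicatorMatrix A S) =
      c • indicatorMatrix A (Relation.Comp R S) := by
  classical
  have hmul (i : m) (j : o) : (indicatorMatrix A R * indicatorMatrix A S) i j =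
      (Finset.card {k | R i k ∧ S k j} : A) := by
    simp only [indicatorMatrix_mul_apply, indicatorMatrix_apply, Finset.sum_boole,
      Finset.filter_filter]
  have hfibre {i : m} {j : o} {k : n} (hk : R i k) (hk' : S k j) :
      Finset.card {l | R i l ∧ S l j} = Finset.card {l | R 0 l ∧ S l 0} := by
    refine Finset.card_bij' (fun l _ => l - k) (fun l _ => l + k) ?_ ?_ ?_ ?_
    · simpa using fun l h h' => ⟨by simpa using hR.sub h hk, by simpa using hS.sub h' hk'⟩
    · simpa using fun l h h' => ⟨by simpa using hR.add h hk, by simpa using hS.add h' hk'⟩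
    · simp
    · simp
  refine ⟨(Finset.card {l | R 0 l ∧ S l 0} : 𝕜), ?_, ?_⟩
  · exact Nat.cast_ne_zero.2 (Finset.card_ne_zero.2 ⟨0, by simpa using ⟨hR.zero, hS.zero⟩⟩)
  · ext i j
    rw [hmul, Matrix.smul_apply, indicatorMatrix_apply, Nat.cast_smul_eq_nsmul, nsmul_eq_mul]
    split_ifs with h
    · obtain ⟨k, hk, hk'⟩ := h
      rw [hfibre hk hk', mul_one]
    · rw [mul_zero, Finset.card_eq_zero.2, Nat.cast_zero]
      exact Finset.filter_eq_empty_iff.2 fun k _ hk => h ⟨k, hk⟩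

end IsAdditiveRel

/-- `T` intertwines `W` and `V`, and its transpose intertwines `V` and `W`. -/
structure IsIntertwiner [Fintype m] [Fintype n] (T : Matrix m n A) (V : Matrix m m A)
    (W : Matrix n n A) : Prop where
  mul_eq : V * T = T * W
  transpose_mul_eq : W * Tᵀ = Tᵀ * V

namespace IsIntertwiner

variable [Fintype m] [Fintype n] [Fintype o] [Fintype q]

lemma transpose {T : Matrix m n A} {V : Matrix m m A} {W : Matrix n n A}
    (h : IsIntertwiner T V W) : IsIntertwiner Tᵀ W V :=
  ⟨h.transpose_mul_eq, h.mul_eq⟩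

lemma one [DecidableEq m] (V : Matrix m m A) : IsIntertwiner 1 V V := by
  constructor <;> simp only [Matrix.transpose_one, mul_one, one_mul]

lemma mul {T : Matrix m n A} {V V' : Matrix m m A} {W W' : Matrix n n A}
    (h : IsIntertwiner T V W) (h' : IsIntertwiner T V' W') :
    IsIntertwiner T (V * V') (W * W') := by
  constructor
  · rw [Matrix.mul_assoc, h'.mul_eq, ← Matrix.mul_assoc, h.mul_eq, Matrix.mul_assoc]
  · rw [Matrix.mul_assoc, h'.transpose_mul_eq, ← Matrix.mul_assoc, h.transpose_mul_eq,
      Matrix.mul_assoc]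

lemma reindex {T : Matrix m n A} {V : Matrix m m A} {W : Matrix n n A} (h : IsIntertwiner T V W)
    (e : o ≃ m) (f : q ≃ n) :
    IsIntertwiner (T.submatrix e f) (V.submatrix e e) (W.submatrix f f) := by
  constructor
  · rw [Matrix.submatrix_mul_equiv, Matrix.submatrix_mul_equiv, h.mul_eq]
  · rw [Matrix.transpose_submatrix, Matrix.submatrix_mul_equiv, Matrix.submatrix_mul_equiv,
      h.transpose_mul_eq]

lemma kronecker {R : m → n → Prop} {S : o → q → Prop} {V : Matrix m m A} {W : Matrix n n A}
    {V' : Matrix o o A} {W' : Matrix q q A} (h : IsIntertwiner (indicatorMatrix A R) V W)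
    (h' : IsIntertwiner (indicatorMatrix A S) V' W') :
    IsIntertwiner (indicatorMatrix A R ⊗ₖ indicatorMatrix A S) (V ⊗ₖ V') (W ⊗ₖ W') := by
  constructor
  · rw [kronecker_mul_kronecker_of_commute fun _ _ i j => (commute_indicatorMatrix R i j _).symm,
      kronecker_mul_kronecker_of_commute fun i j _ _ => commute_indicatorMatrix S i j _,
      h.mul_eq, h'.mul_eq]
  · rw [← Matrix.kroneckerMap_transpose, transpose_indicatorMatrix, transpose_indicatorMatrix,
      kronecker_mul_kronecker_of_commute fun _ _ i j =>
        (commute_indicatorMatrix (flip R) i j _).symm,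
      kronecker_mul_kronecker_of_commute fun i j _ _ => commute_indicatorMatrix (flip S) i j _,
      ← transpose_indicatorMatrix, ← transpose_indicatorMatrix, h.transpose_mul_eq,
      h'.transpose_mul_eq]

end IsIntertwiner

lemma mul_smul_eq_smul_mul_iff {𝕜 : Type*} [Field 𝕜] [Algebra 𝕜 A] [Fintype m] [Fintype n] {c : 𝕜}
    (hc : c ≠ 0) {T : Matrix m n A} {V : Matrix m m A} {W : Matrix n n A} :
    V * c • T = c • T * W ↔ V * T = T * W := by
  rw [Matrix.mul_smul, Matrix.smul_mul, smul_right_inj hc]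

lemma IsIntertwiner.comp (𝕜 : Type*) [Field 𝕜] [CharZero 𝕜] [Algebra 𝕜 A] [AddGroup m]
    [AddGroup n] [AddGroup o] [Fintype m] [Fintype n] [Fintype o]
    {R : m → n → Prop} {S : n → o → Prop} (hR : IsAdditiveRel R) (hS : IsAdditiveRel S)
    {V : Matrix m m A} {W : Matrix n n A} {X : Matrix o o A}
    (h : IsIntertwiner (indicatorMatrix A R) V W) (h' : IsIntertwiner (indicatorMatrix A S) W X) :
    IsIntertwiner (indicatorMatrix A (Relation.Comp R S)) V X := by
  obtain ⟨c, hc, hRS⟩ := hR.exists_indicatorMatrix_mul (A := A) 𝕜 hS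
  have hcomp : V * (indicatorMatrix A R * indicatorMatrix A S) =
      (indicatorMatrix A R * indicatorMatrix A S) * X := by
    rw [← Matrix.mul_assoc, h.mul_eq, Matrix.mul_assoc, h'.mul_eq, Matrix.mul_assoc]
  have hcomp' : X * (indicatorMatrix A R * indicatorMatrix A S)ᵀ =
      (indicatorMatrix A R * indicatorMatrix A S)ᵀ * V := by
    rw [transpose_indicatorMatrix_mul, ← Matrix.mul_assoc, h'.transpose_mul_eq, Matrix.mul_assoc,
      h.transpose_mul_eq, Matrix.mul_assoc]
  rw [hRS] at hcomp hcomp'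
  exact ⟨(mul_smul_eq_smul_mul_iff hc).1 hcomp, (mul_smul_eq_smul_mul_iff hc).1 hcomp'⟩

-- Both matrices on the left are `M = U * V * U' = L * W * L'`.
lemma exists_mul_eq_mul_iff [Fintype ι] [DecidableEq ι] [Fintype m] [Fintype n]
    {U : Matrix ι m A} {U' : Matrix m ι A} {L : Matrix ι n A} {L' : Matrix n ι A}
    (hU : U * U' = 1) (hL : L * L' = 1) {V : Matrix m m A} {W : Matrix n n A} :
    ((∃ M : Matrix ι ι A, U * V = M * U ∧ L * W = M * L) ∧
        ∃ M : Matrix ι ι A, V * U' = U' * M ∧ W * L' = L' * M) ↔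
      V * (U' * L) = U' * L * W ∧ W * (L' * U) = L' * U * V := by
  constructor
  · rintro ⟨⟨M, hUV, hLW⟩, M', hVU', hWL'⟩
    have hM : M = M' := calc
      M = M * U * U' := by rw [Matrix.mul_assoc, hU, Matrix.mul_one]
      _ = U * (V * U') := by rw [← hUV, Matrix.mul_assoc]
      _ = M' := by rw [hVU', ← Matrix.mul_assoc, hU, Matrix.one_mul]
    subst hM
    constructor
    · rw [← Matrix.mul_assoc, hVU', Matrix.mul_assoc, ← hLW, ← Matrix.mul_assoc]
    · rw [← Matrix.mul_assoc, hWL', Matrix.mul_assoc, ← hUV, ← Matrix.mul_assoc]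
  · rintro ⟨hV, hW⟩
    have hVU' : V * U' = U' * (L * W * L') := calc
      V * U' = V * (U' * L) * L' := by simp only [Matrix.mul_assoc, hL, Matrix.mul_one]
      _ = U' * (L * W * L') := by simp only [hV, Matrix.mul_assoc]
    have hWL' : W * L' = L' * (U * V * U') := calc
      W * L' = W * (L' * U) * U' := by simp only [Matrix.mul_assoc, hU, Matrix.mul_one]
      _ = L' * (U * V * U') := by simp only [hW, Matrix.mul_assoc]
    have hUV : U * V = L * W * L' * U := calc
      U * V = L * (L' * U * V) := by simp only [← Matrix.mul_assoc, hL, Matrix.one_mul]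
      _ = L * W * L' * U := by simp only [← hW, Matrix.mul_assoc]
    have hLW : L * W = U * V * U' * L := calc
      L * W = U * (U' * L * W) := by simp only [← Matrix.mul_assoc, hU, Matrix.one_mul]
      _ = U * V * U' * L := by simp only [← hV, Matrix.mul_assoc]
    have hM : L * W * L' = U * V * U' := by rw [hLW, Matrix.mul_assoc _ L, hL, Matrix.mul_one]
    exact ⟨⟨L * W * L', hUV, by rw [hM, hLW]⟩, L * W * L', hVU', by rw [hWL', hM]⟩

lemma isIntertwiner_comp_iff (𝕜 : Type*) [Field 𝕜] [CharZero 𝕜] [Algebra 𝕜 A] [AddGroup ι]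
    [AddGroup m] [AddGroup n] [Fintype ι] [Fintype m] [Fintype n]
    {R : ι → m → Prop} {S : ι → n → Prop} (hR : IsAdditiveRel R)
    (hS : IsAdditiveRel S) (hR' : Relation.Comp R (flip R) = Eq)
    (hS' : Relation.Comp S (flip S) = Eq) {V : Matrix m m A} {W : Matrix n n A} :
    ((∃ M : Matrix ι ι A, indicatorMatrix A R * V = M * indicatorMatrix A R ∧
          indicatorMatrix A S * W = M * indicatorMatrix A S) ∧
        ∃ M : Matrix ι ι A, V * (indicatorMatrix A R)ᵀ = (indicatorMatrix A R)ᵀ * M ∧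
          W * (indicatorMatrix A S)ᵀ = (indicatorMatrix A S)ᵀ * M) ↔
      IsIntertwiner (indicatorMatrix A (Relation.Comp (flip R) S)) V W := by
  classical
  obtain ⟨a, ha, hRR⟩ := hR.exists_indicatorMatrix_mul (A := A) 𝕜 hR.flip
  obtain ⟨b, hb, hSS⟩ := hS.exists_indicatorMatrix_mul (A := A) 𝕜 hS.flip
  obtain ⟨c, hc, hRS⟩ := hR.flip.exists_indicatorMatrix_mul (A := A) 𝕜 hS
  rw [hR', indicatorMatrix_eq, ← transpose_indicatorMatrix] at hRR
  rw [hS', indicatorMatrix_eq, ← transpose_indicatorMatrix] at hSS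
  have hU : indicatorMatrix A R * a⁻¹ • (indicatorMatrix A R)ᵀ = 1 := by
    rw [Matrix.mul_smul, hRR, inv_smul_smul₀ ha]
  have hL : indicatorMatrix A S * b⁻¹ • (indicatorMatrix A S)ᵀ = 1 := by
    rw [Matrix.mul_smul, hSS, inv_smul_smul₀ hb]
  have hT : a⁻¹ • (indicatorMatrix A R)ᵀ * indicatorMatrix A S =
      (a⁻¹ * c) • indicatorMatrix A (Relation.Comp (flip R) S) := by
    rw [Matrix.smul_mul, transpose_indicatorMatrix, hRS, smul_smul]
  have hT' : b⁻¹ • (indicatorMatrix A S)ᵀ * indicatorMatrix A R =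
      (b⁻¹ * c) • (indicatorMatrix A (Relation.Comp (flip R) S))ᵀ := by
    rw [Matrix.smul_mul, ← smul_smul, ← Matrix.transpose_smul, ← hRS,
      transpose_indicatorMatrix_mul]
    rfl
  have h := exists_mul_eq_mul_iff hU hL (V := V) (W := W)
  simp only [hT, hT', mul_smul_eq_smul_mul_iff (inv_ne_zero ha),
    mul_smul_eq_smul_mul_iff (inv_ne_zero hb),
    mul_smul_eq_smul_mul_iff (mul_ne_zero (inv_ne_zero ha) hc),
    mul_smul_eq_smul_mul_iff (mul_ne_zero (inv_ne_zero hb) hc)] at h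
  exact h.trans ⟨fun h => ⟨h.1, h.2⟩, fun h => ⟨h.1, h.2⟩⟩

end Matrices

/-! ### Labelings -/

section Labelings

variable {α β G : Type*}

/-- A labeling `t` of the upper points `α` and a labeling `t'` of the lower points `β` are
compatible with the blocks `r` if together they are constant on every block, that is, if the linear
map associated with the partition has the entry `1` at `(t, t')`. -/
def Compatible (r : Setoid (α ⊕ β)) (t : α → G) (t' : β → G) : Prop :=
  r ≤ Setoid.ker (Sum.elim t t')

lemma isAdditiveRel_compatible [AddGroup G] (r : Setoid (α ⊕ β)) :
    IsAdditiveRel (Compatible r (G := G)) where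
  zero x y _ := by cases x <;> cases y <;> rfl
  sub {t u t' u'} h h' x y hxy := by
    have hsub : Sum.elim (t - u) (t' - u') = Sum.elim t t' - Sum.elim u u' := by
      ext (a | b) <;> rfl
    simpa [Setoid.ker_def, hsub] using congrArg₂ (· - ·) (h hxy) (h' hxy)

lemma compatible_comap_swap (r : Setoid (α ⊕ β)) :
    Compatible (Setoid.comap Sum.swap r) (G := G) = flip (Compatible r) := by
  ext t t'
  constructor
  · rintro h (a | a) (b | b) hab
    all_goals exact h (x := Sum.swap _) (y := Sum.swap _) (by simpa [Setoid.comap_rel] using hab)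
  · rintro h (a | a) (b | b) hab
    all_goals exact h hab

lemma compatible_top_of_unique [Unique α] [Unique β] (t : α → G) (t' : β → G) :
    Compatible ⊤ t t' ↔ t default = t' default := by
  refine ⟨fun h => h (x := .inl default) (y := .inr default) trivial, fun h => ?_⟩
  rintro (a | a) (b | b) -
  all_goals simp [Setoid.ker_def, Unique.eq_default a, Unique.eq_default b, h]

lemma compatible_compBlocks [Nonempty G] {k l m : ℕ} (r : Setoid (Fin k ⊕ Fin l))
    (s : Setoid (Fin l ⊕ Fin m)) :
    Compatible (compBlocks r s) (G := G) = Relation.Comp (Compatible r) (Compatible s) := by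
  ext t t'
  constructor
  · intro h
    set linked := Relation.EqvGen.setoid (Linked r s)
    set q : Fin k ⊕ Fin m → Quotient linked := fun x => ⟦Sum.map id Sum.inr x⟧
    obtain ⟨w, hw⟩ : ∃ w : Quotient linked → G, w ∘ q = Sum.elim t t' :=
      ((Function.factorsThrough_iff (f := q) _).1 fun x y hxy =>
        h (Quotient.exact (s := linked) hxy)).imp
        fun _ => Eq.symm
    have hupper (a : Fin k) : t a = w ⟦.inl a⟧ := (congrFun hw (.inl a)).symm
    have hlower (a : Fin m) : t' a = w ⟦.inr (.inr a)⟧ := (congrFun hw (.inr a)).symm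
    refine ⟨fun b => w ⟦.inr (.inl b)⟧, ?_, ?_⟩
    · intro x y hxy
      have := congrArg w (Quotient.sound (.rel _ _ (.above hxy) : linked _ _))
      rcases x with a | a <;> rcases y with b | b <;>
        simpa [Setoid.ker_def, hupper] using this
    · intro x y hxy
      have := congrArg w (Quotient.sound (.rel _ _ (.below hxy) : linked _ _))
      rcases x with a | a <;> rcases y with b | b <;>
        simpa [Setoid.ker_def, hlower] using this
  · rintro ⟨u, hr, hs⟩ x y hxy
    have hlinked : Relation.EqvGen.setoid (Linked r s) ≤
        Setoid.ker (Sum.elim t (Sum.elim u t')) := by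
      refine Setoid.eqvGen_le fun x y hxy => ?_
      rcases hxy with @⟨a, b, hab⟩ | @⟨a, b, hab⟩
      · rcases a with a | a <;> rcases b with b | b <;> exact hr hab
      · exact hs hab
    rcases x with a | a <;> rcases y with b | b <;> exact hlinked hxy

end Labelings

lemma compatible_tensor_append {G : Type*} (p q : TwoColouredPartition) (t : Fin p.k → G)
    (t' : Fin p.l → G) (u : Fin q.k → G) (u' : Fin q.l → G) :
    Compatible (tensor p q).blocks (Fin.append t u) (Fin.append t' u') ↔
      Compatible p.blocks t t' ∧ Compatible q.blocks u u' := by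
  set e : Fin (p.k + q.k) ⊕ Fin (p.l + q.l) ≃ (Fin p.k ⊕ Fin p.l) ⊕ (Fin q.k ⊕ Fin q.l) :=
    (Equiv.sumCongr finSumFinEquiv.symm finSumFinEquiv.symm).trans (Equiv.sumSumSumComm _ _ _ _)
  have hlabels (x) : Sum.elim (Fin.append t u) (Fin.append t' u') (e.symm x) =
      Sum.elim (Sum.elim t t') (Sum.elim u u') x := by
    rcases x with (a | a) | (a | a) <;> simp [e]
  have hblocks (x y) : (tensor p q).blocks (e.symm x) (e.symm y) ↔
      Sum.LiftRel p.blocks q.blocks x y := by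
    change Sum.LiftRel p.blocks q.blocks (e (e.symm x)) (e (e.symm y)) ↔ _
    rw [e.apply_symm_apply, e.apply_symm_apply]
  have hcompatible : Compatible (tensor p q).blocks (Fin.append t u) (Fin.append t' u') ↔
      ∀ x y, Sum.LiftRel p.blocks q.blocks x y → Sum.elim (Sum.elim t t') (Sum.elim u u') x =
        Sum.elim (Sum.elim t t') (Sum.elim u u') y := by
    simp only [← hlabels, ← hblocks]
    exact e.symm.forall_congr_right.symm.trans
      (forall_congr' fun x => e.symm.forall_congr_right.symm)
  rw [hcompatible]
  constructor
  · exact fun h => ⟨fun x y hxy => h _ _ (.inl hxy), fun x y hxy => h _ _ (.inr hxy)⟩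
  · rintro ⟨hp, hq⟩ _ _ (hxy | hxy)
    exacts [hp hxy, hq hxy]

section RowLabelings

variable (p : TwoColouredPartition) {α : Type*}

instance : Finite p.ThroughBlock :=
  inferInstanceAs (Finite {_b : Quotient p.blocks // _})

instance : Fintype p.ThroughBlock := Fintype.ofFinite _

instance : DecidableEq p.ThroughBlock := Classical.decEq _

/-- The labeling `t` of a row of points of `p`, included by `row` into all points, is valid and
restricts to the labeling `i` of the through-blocks. For the upper and the lower row this is
membership in `upperClass` and `lowerClass`. -/
def RestrictsTo (G : Type*) (row : α → Fin p.k ⊕ Fin p.l) (i : p.ThroughBlock → G)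
    (t : α → G) : Prop :=
  (∀ a b, p.blocks (row a) (row b) → t a = t b) ∧
    ∀ (b : p.ThroughBlock) (a : α), Quotient.mk p.blocks (row a) = b.1 → t a = i b

variable {p} {G : Type*} {row : α → Fin p.k ⊕ Fin p.l}

lemma isAdditiveRel_restrictsTo [AddGroup G] (row : α → Fin p.k ⊕ Fin p.l) :
    IsAdditiveRel (RestrictsTo p G row) where
  zero := ⟨fun _ _ _ => rfl, fun _ _ _ => rfl⟩
  sub h h' := ⟨fun a b hab => congrArg₂ (· - ·) (h.1 a b hab) (h'.1 a b hab),
    fun b a hab => congrArg₂ (· - ·) (h.2 b a hab) (h'.2 b a hab)⟩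

lemma exists_restrictsTo_left
    (hrow : ∀ b : p.ThroughBlock, ∃ a, Quotient.mk p.blocks (row a) = b.1) {t : α → G}
    (ht : ∀ a b, p.blocks (row a) (row b) → t a = t b) : ∃ i, RestrictsTo p G row i t := by
  choose a ha using hrow
  exact ⟨fun b => t (a b), ht, fun b c hc => ht c (a b) (Quotient.exact (hc.trans (ha b).symm))⟩

lemma exists_restrictsTo_right [Nonempty G] (row : α → Fin p.k ⊕ Fin p.l)
    (i : p.ThroughBlock → G) : ∃ t, RestrictsTo p G row i t := by
  refine ⟨fun a => Function.extend Subtype.val i (fun _ => Classical.arbitrary G)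
    (Quotient.mk p.blocks (row a)), fun a b hab => ?_, fun b a hab => ?_⟩
  · exact congrArg _ (Quotient.sound hab)
  · simp only [hab]
    exact Subtype.val_injective.extend_apply i _ b

lemma restrictsTo_left_unique
    (hrow : ∀ b : p.ThroughBlock, ∃ a, Quotient.mk p.blocks (row a) = b.1)
    {i j : p.ThroughBlock → G} {t : α → G} (hi : RestrictsTo p G row i t)
    (hj : RestrictsTo p G row j t) : i = j := by
  funext b
  obtain ⟨a, ha⟩ := hrow b
  exact (hi.2 b a ha).symm.trans (hj.2 b a ha)

lemma comp_restrictsTo_flip [Nonempty G]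
    (hrow : ∀ b : p.ThroughBlock, ∃ a, Quotient.mk p.blocks (row a) = b.1) :
    Relation.Comp (RestrictsTo p G row) (flip (RestrictsTo p G row)) = Eq := by
  ext i j
  constructor
  · rintro ⟨t, hi, hj⟩
    exact restrictsTo_left_unique hrow hi hj
  · rintro rfl
    obtain ⟨t, ht⟩ := exists_restrictsTo_right row i
    exact ⟨t, ht, ht⟩

lemma compatible_blocks (p : TwoColouredPartition) :
    Compatible p.blocks (G := G) =
      Relation.Comp (flip (RestrictsTo p G Sum.inl)) (RestrictsTo p G Sum.inr) := by
  ext t t'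
  constructor
  · intro h
    obtain ⟨i, hi⟩ := exists_restrictsTo_left (fun b => b.2.1) (t := t)
      fun a b hab => h hab
    refine ⟨i, hi, fun a b hab => h hab, fun b a' hb => ?_⟩
    obtain ⟨a, ha⟩ := b.2.1
    rw [← hi.2 b a ha]
    exact h (Quotient.exact (hb.trans ha.symm))
  · rintro ⟨i, hi, hi'⟩
    have hthrough (a : Fin p.k) (b : Fin p.l) (hab : p.blocks (.inl a) (.inr b)) :
        t a = t' b := by
      let c : p.ThroughBlock := ⟨_, ⟨a, rfl⟩, b, (Quotient.sound hab).symm⟩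
      rw [hi.2 c a rfl, hi'.2 c b (Quotient.sound hab).symm]
    rintro (a | a) (b | b) hab
    exacts [hi.1 a b hab, hthrough a b hab, (hthrough b a (p.blocks.symm' hab)).symm,
      hi'.1 a b hab]

end RowLabelings

/-! ### Quantum space relations as matrix identities -/

section WordMatrix

variable {A B : Type u} {I J K : Type*}

lemma Colour.map_pow [Star A] [Star B] {F : Type*} [FunLike F A B] [StarHomClass F A B] (φ : F)
    (c : Colour) (a : A) : φ (c.pow a) = c.pow (φ a) := by
  cases c
  exacts [rfl, map_star φ a]

/-- The matrix with entries `x_{t₁γ₁}^{ω₁} ⋯ x_{t_kγ_k}^{ω_k}`: the coloured tensor power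
`x^{⊗ω}`. -/
def wordMatrix [Monoid A] [Star A] {k : ℕ} (ω : Fin k → Colour) (x : Matrix I J A) :
    Matrix (Fin k → I) (Fin k → J) A :=
  .of fun t γ => (List.ofFn fun a => (ω a).pow (x (t a) (γ a))).prod

lemma commute_wordMatrix [Monoid A] [Star A] {k : ℕ} (ω : Fin k → Colour) {x : Matrix I J A}
    {b : A} (h : ∀ (c : Colour) i j, Commute (c.pow (x i j)) b) (t : Fin k → I) (γ : Fin k → J) :
    Commute (wordMatrix ω x t γ) b :=
  Commute.list_prod_left _ _ <| by
    simpa only [List.forall_mem_ofFn_iff] using fun a => h (ω a) (t a) (γ a)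

variable [Ring A] [StarRing A]

lemma wordMatrix_append {k l : ℕ} (ω : Fin k → Colour) (ω' : Fin l → Colour) (x : Matrix I J A) :
    (wordMatrix (Fin.append ω ω') x).submatrix (Fin.appendEquiv k l) (Fin.appendEquiv k l) =
      wordMatrix ω x ⊗ₖ wordMatrix ω' x := by
  ext ⟨t, t'⟩ ⟨γ, γ'⟩
  simp [wordMatrix, Fin.appendEquiv, List.ofFn_add]

lemma wordMatrix_succ {k : ℕ} (ω : Fin (k + 1) → Colour) (x : Matrix I J A) :
    (wordMatrix ω x).submatrix (Fin.consEquiv fun _ => I) (Fin.consEquiv fun _ => J) =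
      x.map (ω 0).pow ⊗ₖ wordMatrix (Fin.tail ω) x := by
  ext ⟨i, t⟩ ⟨j, γ⟩
  simp [wordMatrix, Fin.tail, Colour.pow]

lemma wordMatrix_one [DecidableEq I] {k : ℕ} (ω : Fin k → Colour) :
    wordMatrix ω (1 : Matrix I I A) = 1 := by
  ext t γ
  have hpow (a : Fin k) : (ω a).pow ((1 : Matrix I I A) (t a) (γ a)) =
      (1 : Matrix I I A) (t a) (γ a) := by
    cases ω a
    exacts [rfl, by rw [Matrix.one_apply]; split_ifs; exacts [star_one A, star_zero A]]
  simp only [wordMatrix, Matrix.of_apply, hpow]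
  by_cases h : t = γ
  · subst h
    simp only [Matrix.one_apply_eq, List.ofFn_const, List.prod_replicate, one_pow]
  · obtain ⟨a, ha⟩ := Function.ne_iff.1 h
    rw [Matrix.one_apply_ne h, List.prod_eq_zero]
    exact List.mem_ofFn.2 ⟨a, Matrix.one_apply_ne ha⟩

lemma map_pow_mul [Fintype J] {x : Matrix I J A} {y : Matrix J K A}
    (h : ∀ i j j' k, Commute (x i j) (y j' k)) (c : Colour) :
    (x * y).map c.pow = x.map c.pow * y.map c.pow := by
  ext i j
  cases c
  · rfl
  · simp only [Matrix.map_apply, Matrix.mul_apply, Colour.pow, star_sum, star_mul]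
    exact Finset.sum_congr rfl fun k _ => (h i k k j).star_star.symm

lemma wordMatrix_mul [Fintype J] {x : Matrix I J A} {y : Matrix J K A}
    (h : ∀ (c c' : Colour) i j i' j', Commute (c.pow (x i j)) (c'.pow (y i' j'))) :
    ∀ {k : ℕ} (ω : Fin k → Colour), wordMatrix ω (x * y) = wordMatrix ω x * wordMatrix ω y
  | 0, ω => by
    ext t γ
    rw [Matrix.mul_apply, Fintype.sum_unique]
    exact (mul_one _).symm
  | k + 1, ω => by
    have hcommute (i j t γ) : Commute (wordMatrix (Fin.tail ω) x t γ) (y.map (ω 0).pow i j) :=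
      commute_wordMatrix _ (fun c i' j' => h c (ω 0) i' j' i j) t γ
    have hentries (i j j' k) : Commute (x i j) (y j' k) := h .white .white i j j' k
    refine (Matrix.reindex (Fin.consEquiv fun _ => I).symm
      (Fin.consEquiv fun _ => K).symm).injective ?_
    simp only [Matrix.reindex_apply, Equiv.symm_symm]
    rw [← Matrix.submatrix_mul_equiv _ _ _ (Fin.consEquiv fun _ => J), wordMatrix_succ,
      wordMatrix_succ, wordMatrix_succ, map_pow_mul hentries, wordMatrix_mul h,
      kronecker_mul_kronecker_of_commute fun t γ i j => hcommute i j t γ]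

end WordMatrix

namespace TwoColouredPartition

variable {N : ℕ} {A : Type u} [Ring A] [StarRing A]

lemma indicatorMatrix_mul_wordMatrix_upper (p : TwoColouredPartition)
    (x : Matrix (Fin N) (Fin N) A) (i : p.ThroughBlock → Fin N) (γ : Fin p.k → Fin N) :
    (indicatorMatrix A (RestrictsTo p (Fin N) .inl) * wordMatrix p.upper x) i γ =
      p.upperSum x i γ := by
  classical
  rw [indicatorMatrix_mul_apply]
  exact Finset.sum_congr (by ext; rfl) fun _ _ => rfl

lemma indicatorMatrix_mul_wordMatrix_lower (p : TwoColouredPartition)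
    (x : Matrix (Fin N) (Fin N) A) (i : p.ThroughBlock → Fin N) (γ : Fin p.l → Fin N) :
    (indicatorMatrix A (RestrictsTo p (Fin N) .inr) * wordMatrix p.lower x) i γ =
      p.lowerSum x i γ := by
  classical
  rw [indicatorMatrix_mul_apply]
  exact Finset.sum_congr (by ext; rfl) fun _ _ => rfl

variable [NeZero N]

lemma spaceRelations_iff {p : TwoColouredPartition} {x : Matrix (Fin N) (Fin N) A} :
    p.SpaceRelations le_rfl x ↔ ∃ M : Matrix (p.ThroughBlock → Fin N) (p.ThroughBlock → Fin N) A,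
      indicatorMatrix A (RestrictsTo p (Fin N) .inl) * wordMatrix p.upper x =
          M * indicatorMatrix A (RestrictsTo p (Fin N) .inl) ∧
        indicatorMatrix A (RestrictsTo p (Fin N) .inr) * wordMatrix p.lower x =
          M * indicatorMatrix A (RestrictsTo p (Fin N) .inr) := by
  have hrow : ∀ b : p.ThroughBlock, ∃ a, Quotient.mk p.blocks (.inl a) = b.1 := fun b => b.2.1
  have hrow' : ∀ b : p.ThroughBlock, ∃ a, Quotient.mk p.blocks (.inr a) = b.1 := fun b => b.2.2
  have hunique (i j : p.ThroughBlock → Fin N) (t : Fin p.k → Fin N) :=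
    restrictsTo_left_unique hrow (i := i) (j := j) (t := t)
  have hunique' (i j : p.ThroughBlock → Fin N) (t : Fin p.l → Fin N) :=
    restrictsTo_left_unique hrow' (i := i) (j := j) (t := t)
  constructor
  · intro h
    choose γ hγ using exists_restrictsTo_right (p := p) (G := Fin N) .inl
    choose γ' hγ' using exists_restrictsTo_right (p := p) (G := Fin N) .inr
    refine ⟨fun i j => p.upperSum x i (γ j),
      (eq_mul_indicatorMatrix_iff hunique).2 ⟨fun i j t ht => ?_, fun i t ht => ?_⟩,
      (eq_mul_indicatorMatrix_iff hunique').2 ⟨fun i j t ht => ?_, fun i t ht => ?_⟩⟩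
    · rw [indicatorMatrix_mul_wordMatrix_upper, h.valid i j t (γ' j) ht (hγ' j),
        h.valid i j (γ j) (γ' j) (hγ j) (hγ' j)]
    · rw [indicatorMatrix_mul_wordMatrix_upper,
        h.upper_invalid i t fun ht' => (exists_restrictsTo_left hrow ht').elim ht]
    · rw [indicatorMatrix_mul_wordMatrix_lower, h.valid i j (γ j) t (hγ j) ht]
    · rw [indicatorMatrix_mul_wordMatrix_lower,
        h.lower_invalid i t fun ht' => (exists_restrictsTo_left hrow' ht').elim ht]
  · rintro ⟨M, hM, hM'⟩
    obtain ⟨hvalid, hinvalid⟩ := (eq_mul_indicatorMatrix_iff hunique).1 hM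
    obtain ⟨hvalid', hinvalid'⟩ := (eq_mul_indicatorMatrix_iff hunique').1 hM'
    simp only [indicatorMatrix_mul_wordMatrix_upper] at hvalid hinvalid
    simp only [indicatorMatrix_mul_wordMatrix_lower] at hvalid' hinvalid'
    exact ⟨fun i j γ γ' hγ hγ' => (hvalid i j γ hγ).trans (hvalid' i j γ' hγ').symm,
      fun i γ hγ => hinvalid i γ fun j hj => hγ hj.1,
      fun i γ hγ => hinvalid' i γ fun j hj => hγ hj.1⟩

lemma spaceRelations_one (p : TwoColouredPartition) :
    p.SpaceRelations le_rfl (1 : Matrix (Fin N) (Fin N) A) := by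
  classical
  refine spaceRelations_iff.2 ⟨1, ?_, ?_⟩ <;> rw [wordMatrix_one, Matrix.mul_one, Matrix.one_mul]

lemma SpaceRelations.mul {p : TwoColouredPartition} {x y : Matrix (Fin N) (Fin N) A}
    (h : ∀ (c c' : Colour) i j i' j', Commute (c.pow (x i j)) (c'.pow (y i' j')))
    (hx : p.SpaceRelations le_rfl x) (hy : p.SpaceRelations le_rfl y) :
    p.SpaceRelations le_rfl (x * y) := by
  obtain ⟨M, hM, hM'⟩ := spaceRelations_iff.1 hx
  obtain ⟨L, hL, hL'⟩ := spaceRelations_iff.1 hy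
  refine spaceRelations_iff.2 ⟨M * L, ?_, ?_⟩
  · rw [wordMatrix_mul h, ← Matrix.mul_assoc, hM, Matrix.mul_assoc, hL, Matrix.mul_assoc]
  · rw [wordMatrix_mul h, ← Matrix.mul_assoc, hM', Matrix.mul_assoc, hL', Matrix.mul_assoc]

lemma spaceRelations_and_transpose_iff [Algebra ℂ A] {p : TwoColouredPartition}
    {x : Matrix (Fin N) (Fin N) A} :
    p.SpaceRelations le_rfl x ∧ p.SpaceRelations le_rfl xᵀ ↔
      IsIntertwiner (indicatorMatrix A (Compatible p.blocks)) (wordMatrix p.upper x)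
        (wordMatrix p.lower x) := by
  have htranspose : p.SpaceRelations le_rfl xᵀ ↔
      ∃ M : Matrix (p.ThroughBlock → Fin N) (p.ThroughBlock → Fin N) A,
        wordMatrix p.upper x * (indicatorMatrix A (RestrictsTo p (Fin N) .inl))ᵀ =
            (indicatorMatrix A (RestrictsTo p (Fin N) .inl))ᵀ * M ∧
          wordMatrix p.lower x * (indicatorMatrix A (RestrictsTo p (Fin N) .inr))ᵀ =
            (indicatorMatrix A (RestrictsTo p (Fin N) .inr))ᵀ * M := by
    refine spaceRelations_iff.trans (Iff.trans ?_
      (Matrix.transposeAddEquiv _ _ A).surjective.exists.symm)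
    exact exists_congr fun M => and_congr indicatorMatrix_mul_transpose_eq_iff
      indicatorMatrix_mul_transpose_eq_iff
  rw [spaceRelations_iff, htranspose, compatible_blocks]
  exact isIntertwiner_comp_iff ℂ (isAdditiveRel_restrictsTo _) (isAdditiveRel_restrictsTo _)
    (comp_restrictsTo_flip fun b => b.2.1) (comp_restrictsTo_flip fun b => b.2.2)

end TwoColouredPartition

/-! ### Solutions of the relations for a matrix and its transpose -/

namespace TwoColouredPartition

variable {N : ℕ} {A : Type u} [Ring A] [StarRing A]

/-- The partitions `p` such that the linear map `T_p` and its transpose intertwine the coloured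
tensor powers of `x` belonging to the upper and to the lower row of `p`. -/
def intertwinedPartitions (x : Matrix (Fin N) (Fin N) A) : Set TwoColouredPartition :=
  {p | IsIntertwiner (indicatorMatrix A (Compatible p.blocks)) (wordMatrix p.upper x)
    (wordMatrix p.lower x)}

/-- `x` and its transpose satisfy the quantum space relations of all partitions in `P`: the
relations between the entries of the matrix of a quantum group acting on `X_{N,N}(P)`. -/
def Admissible (P : Set TwoColouredPartition) (x : Matrix (Fin N) (Fin N) A) : Prop :=
  ∀ p ∈ P, p.SpaceRelations le_rfl x ∧ p.SpaceRelations le_rfl xᵀ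

variable {x : Matrix (Fin N) (Fin N) A}

lemma idPartition_mem_intertwinedPartitions (c : Colour) :
    idPartition c ∈ intertwinedPartitions x := by
  have hblocks : Compatible (⊤ : Setoid (Fin 1 ⊕ Fin 1)) (G := Fin N) = Eq := by
    ext t t'
    exact (compatible_top_of_unique t t').trans
      ⟨fun h => funext fun a => by rwa [Unique.eq_default a], fun h => congrFun h _⟩
  change IsIntertwiner (indicatorMatrix A (Compatible (⊤ : Setoid (Fin 1 ⊕ Fin 1))))
    (wordMatrix ![c] x) (wordMatrix ![c] x)
  rw [hblocks, indicatorMatrix_eq]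
  exact .one _

lemma tensor_mem_intertwinedPartitions {p q : TwoColouredPartition}
    (hp : p ∈ intertwinedPartitions x) (hq : q ∈ intertwinedPartitions x) :
    tensor p q ∈ intertwinedPartitions x := by
  classical
  let R : (Fin (p.k + q.k) → Fin N) → (Fin (p.l + q.l) → Fin N) → Prop :=
    Compatible (tensor p q).blocks
  have hR : (indicatorMatrix A R).submatrix (Fin.appendEquiv p.k q.k) (Fin.appendEquiv p.l q.l) =
      indicatorMatrix A (Compatible p.blocks) ⊗ₖ indicatorMatrix A (Compatible q.blocks) := by
    rw [indicatorMatrix_kronecker]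
    ext ⟨t, u⟩ ⟨t', u'⟩
    rw [Matrix.submatrix_apply, indicatorMatrix_apply, indicatorMatrix_apply]
    exact if_congr (compatible_tensor_append p q t t' u u') rfl rfl
  have h := (IsIntertwiner.kronecker hp hq).reindex (Fin.appendEquiv p.k q.k).symm
    (Fin.appendEquiv p.l q.l).symm
  rw [← hR, ← wordMatrix_append, ← wordMatrix_append] at h
  simp only [Matrix.submatrix_submatrix, Equiv.self_comp_symm, Matrix.submatrix_id_id] at h
  exact h

lemma involution_mem_intertwinedPartitions {p : TwoColouredPartition}
    (hp : p ∈ intertwinedPartitions x) : involution p ∈ intertwinedPartitions x := by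
  have h := IsIntertwiner.transpose hp
  rwa [transpose_indicatorMatrix, ← compatible_comap_swap] at h

lemma compatible_top_fin_two {G : Type*} (t : Fin 0 → G) (t' : Fin 2 → G) :
    Compatible ⊤ t t' ↔ t' 0 = t' 1 := by
  refine ⟨fun h => h (x := .inr (0 : Fin 2)) (y := .inr (1 : Fin 2)) trivial, fun h => ?_⟩
  have hconst (a b : Fin 2) : t' a = t' b := by fin_cases a <;> fin_cases b <;> simp [h]
  rintro (a | a) (b | b) -
  exacts [a.elim0, a.elim0, b.elim0, hconst a b]

lemma mul_eq_one_of_lowerPair_mem_intertwinedPartitions {c c' : Colour}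
    (h : lowerPair c c' ∈ intertwinedPartitions x) :
    (x.map c.pow)ᵀ * x.map c'.pow = 1 ∧ x.map c.pow * (x.map c'.pow)ᵀ = 1 := by
  classical
  change IsIntertwiner (indicatorMatrix A (Compatible (⊤ : Setoid (Fin 0 ⊕ Fin 2))))
    (wordMatrix ![] x) (wordMatrix ![c, c'] x) at h
  have hword (t γ : Fin 2 → Fin N) : wordMatrix ![c, c'] x t γ =
      c.pow (x (t 0) (γ 0)) * c'.pow (x (t 1) (γ 1)) := by
    simp [wordMatrix, List.ofFn_succ]
  have hempty (t γ : Fin 0 → Fin N) : wordMatrix ![] x t γ = 1 := rfl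
  have hT (t : Fin 0 → Fin N) (γ : Fin 2 → Fin N) :
      indicatorMatrix A (Compatible (⊤ : Setoid (Fin 0 ⊕ Fin 2))) t γ =
        (1 : Matrix (Fin N) (Fin N) A) (γ 0) (γ 1) := by
    rw [indicatorMatrix_apply, Matrix.one_apply]
    exact if_congr (compatible_top_fin_two t γ) rfl rfl
  have hsum (f : (Fin 2 → Fin N) → A) : ∑ t, f t = ∑ i, ∑ j, f ![i, j] := by
    rw [← (finTwoArrowEquiv (Fin N)).symm.sum_comp, Fintype.sum_prod_type]
    rfl
  constructor <;> ext i j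
  · have := congrFun (congrFun h.mul_eq default) ![i, j]
    simpa [Matrix.mul_apply, hword, hempty, hT, hsum, Matrix.one_apply] using this.symm
  · have := congrFun (congrFun h.transpose_mul_eq ![i, j]) default
    simpa [Matrix.mul_apply, hword, hempty, hT, hsum, Matrix.one_apply] using this

variable [NeZero N] [Algebra ℂ A]

lemma isCategory_intertwinedPartitions (h : mixedPairs ⊆ intertwinedPartitions x) :
    IsCategory (intertwinedPartitions x) where
  id_mem := idPartition_mem_intertwinedPartitions
  mixedPairs_subset := h
  tensor_mem _ hp _ hq := tensor_mem_intertwinedPartitions hp hq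
  involution_mem _ := involution_mem_intertwinedPartitions
  comp_mem ω ω' ω'' r s hr hs := by
    change IsIntertwiner (indicatorMatrix A (Compatible (compBlocks r s))) (wordMatrix ω x)
      (wordMatrix ω'' x)
    rw [compatible_compBlocks]
    exact .comp ℂ (isAdditiveRel_compatible r) (isAdditiveRel_compatible s) hr hs

lemma generatedCategory_subset_intertwinedPartitions_iff {P : Set TwoColouredPartition}
    (hP : mixedPairs ⊆ P) :
    generatedCategory P ⊆ intertwinedPartitions x ↔ P ⊆ intertwinedPartitions x :=
  ⟨(Set.subset_sInter fun _ hC => hC.2).trans,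
    fun h => Set.sInter_subset_of_mem ⟨isCategory_intertwinedPartitions (hP.trans h), h⟩⟩

lemma admissible_iff_subset {P : Set TwoColouredPartition} :
    Admissible P x ↔ P ⊆ intertwinedPartitions x :=
  forall₂_congr fun _ _ => spaceRelations_and_transpose_iff

lemma admissible_congr {P P' : Set TwoColouredPartition} (hP : mixedPairs ⊆ P)
    (hP' : mixedPairs ⊆ P') (h : generatedCategory P = generatedCategory P') :
    Admissible P x ↔ Admissible P' x := by
  rw [admissible_iff_subset, admissible_iff_subset,
    ← generatedCategory_subset_intertwinedPartitions_iff hP,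
    ← generatedCategory_subset_intertwinedPartitions_iff hP', h]

lemma Admissible.mul {P : Set TwoColouredPartition} {y : Matrix (Fin N) (Fin N) A}
    (h : ∀ (c c' : Colour) i j i' j', Commute (c.pow (x i j)) (c'.pow (y i' j')))
    (hx : Admissible P x) (hy : Admissible P y) : Admissible P (x * y) := by
  rw [admissible_iff_subset] at hx hy ⊢
  intro p hp
  have hxy := (hx hp).mul (hy hp)
  rwa [← wordMatrix_mul h, ← wordMatrix_mul h] at hxy

end TwoColouredPartition

namespace TwoColouredPartition

namespace Admissible

variable {N : ℕ} [NeZero N] {A : Type u} [Ring A] [StarRing A] [Algebra ℂ A]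
  {P : Set TwoColouredPartition} {x : Matrix (Fin N) (Fin N) A}

lemma map_pow_mul_eq_one (hP : mixedPairs ⊆ P) (h : Admissible P x) {c c' : Colour}
    (hc : lowerPair c c' ∈ mixedPairs) :
    (x.map c.pow)ᵀ * x.map c'.pow = 1 ∧ x.map c.pow * (x.map c'.pow)ᵀ = 1 :=
  mul_eq_one_of_lowerPair_mem_intertwinedPartitions (admissible_iff_subset.1 h (hP hc))

lemma isUnit (hP : mixedPairs ⊆ P) (h : Admissible P x) : IsUnit x := by
  have hwhite := h.map_pow_mul_eq_one hP (c := .white) (c' := .black) (by simp [mixedPairs])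
  have hblack := h.map_pow_mul_eq_one hP (c := .black) (c' := .white) (by simp [mixedPairs])
  exact ⟨⟨x, xᴴ, hwhite.2, hblack.1⟩, rfl⟩

lemma isUnit_conj (hP : mixedPairs ⊆ P) (h : Admissible P x) : IsUnit (x.map star) := by
  have hwhite := h.map_pow_mul_eq_one hP (c := .white) (c' := .black) (by simp [mixedPairs])
  have hblack := h.map_pow_mul_eq_one hP (c := .black) (c' := .white) (by simp [mixedPairs])
  exact ⟨⟨x.map star, xᵀ, hblack.2, hwhite.1⟩, rfl⟩

end Admissible

section Relator

variable {N d : ℕ} {A B : Type u} [Ring A] [StarRing A] [Algebra ℂ A] [Ring B] [StarRing B]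
  [Algebra ℂ B] {p : TwoColouredPartition} {hd : d ≤ N} {x : Fin N → Fin d → A}

lemma map_upperSum (φ : A →⋆ₐ[ℂ] B) (x : Fin N → Fin d → A) (i : p.ThroughBlock → Fin N)
    (γ : Fin p.k → Fin d) : φ (p.upperSum x i γ) = p.upperSum (fun i j => φ (x i j)) i γ := by
  simp only [upperSum, map_sum, map_list_prod, List.map_ofFn, Function.comp_def, Colour.map_pow]

lemma map_lowerSum (φ : A →⋆ₐ[ℂ] B) (x : Fin N → Fin d → A) (i : p.ThroughBlock → Fin N)
    (γ : Fin p.l → Fin d) : φ (p.lowerSum x i γ) = p.lowerSum (fun i j => φ (x i j)) i γ := by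
  simp only [lowerSum, map_sum, map_list_prod, List.map_ofFn, Function.comp_def, Colour.map_pow]

/-- The elements that the quantum space relations of `p` set to zero. They reduce questions about
these relations to the vanishing of elements of a ⋆-algebra. -/
inductive Relator (p : TwoColouredPartition) (hd : d ≤ N) (x : Fin N → Fin d → A) : A → Prop
  | valid (i j : p.ThroughBlock → Fin N) (γ : Fin p.k → Fin d) (γ' : Fin p.l → Fin d)
      (hγ : (fun a => Fin.castLE hd (γ a)) ∈ p.upperClass j)
      (hγ' : (fun a => Fin.castLE hd (γ' a)) ∈ p.lowerClass j) :
      Relator p hd x (p.upperSum x i γ - p.lowerSum x i γ')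
  | upper_invalid (i : p.ThroughBlock → Fin N) (γ : Fin p.k → Fin d)
      (hγ : ¬ p.ValidUpper fun a => Fin.castLE hd (γ a)) : Relator p hd x (p.upperSum x i γ)
  | lower_invalid (i : p.ThroughBlock → Fin N) (γ : Fin p.l → Fin d)
      (hγ : ¬ p.ValidLower fun a => Fin.castLE hd (γ a)) : Relator p hd x (p.lowerSum x i γ)

lemma spaceRelations_map_iff (φ : A →⋆ₐ[ℂ] B) :
    p.SpaceRelations hd (fun i j => φ (x i j)) ↔ ∀ a, Relator p hd x a → φ a = 0 := by
  constructor
  · rintro h _ (⟨i, j, γ, γ', hγ, hγ'⟩ | ⟨i, γ, hγ⟩ | ⟨i, γ, hγ⟩)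
    · rw [map_sub, map_upperSum, map_lowerSum, h.valid i j γ γ' hγ hγ', sub_self]
    · rw [map_upperSum, h.upper_invalid i γ hγ]
    · rw [map_lowerSum, h.lower_invalid i γ hγ]
  · intro h
    refine ⟨fun i j γ γ' hγ hγ' => ?_, fun i γ hγ => ?_, fun i γ hγ => ?_⟩
    · rw [← sub_eq_zero, ← map_upperSum, ← map_lowerSum, ← map_sub]
      exact h _ (.valid i j γ γ' hγ hγ')
    · rw [← map_upperSum]
      exact h _ (.upper_invalid i γ hγ)
    · rw [← map_lowerSum]
      exact h _ (.lower_invalid i γ hγ)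

lemma spaceRelations_iff_relator : p.SpaceRelations hd x ↔ ∀ a, Relator p hd x a → a = 0 :=
  spaceRelations_map_iff (StarAlgHom.id ℂ A)

lemma SpaceRelations.map (h : p.SpaceRelations hd x) (φ : A →⋆ₐ[ℂ] B) :
    p.SpaceRelations hd fun i j => φ (x i j) :=
  (spaceRelations_map_iff φ).2 fun a ha => by
    rw [spaceRelations_iff_relator.1 h a ha, map_zero]

lemma Admissible.map {P : Set TwoColouredPartition} {x : Matrix (Fin N) (Fin N) A}
    (h : Admissible P x) (φ : A →⋆ₐ[ℂ] B) : Admissible P (x.map φ) :=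
  fun p hp => ⟨(h p hp).1.map φ, (h p hp).2.map φ⟩

lemma spaceRelations_gen {X : Type u} (R : CStarRelations X) (f : Fin N → Fin d → X)
    (h : ∀ (B : Type u) [CStarAlgebra B] (y : X → B), R.Holds B y →
      p.SpaceRelations hd fun i j => y (f i j)) :
    p.SpaceRelations hd fun i j => R.gen (f i j) := by
  refine (spaceRelations_map_iff (x := fun i j => FreeStarAlgebra.of (f i j))
    R.universalSeminorm.toCompletion).2 fun a ha => R.toCompletion_eq_zero fun B _ y hy => ?_
  refine (spaceRelations_map_iff (FreeStarAlgebra.eval y)).1 ?_ a ha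
  simpa only [FreeStarAlgebra.eval_of] using h B y hy

end Relator

section MinTensor

variable {N : ℕ} {A B : Type u} [CStarAlgebra A] [CStarAlgebra B]

lemma map_minTensorLeft_mul_map_minTensorRight (a : Matrix (Fin N) (Fin N) A)
    (b : Matrix (Fin N) (Fin N) B) :
    a.map minTensorLeft * b.map minTensorRight = .of fun i j => ∑ k, minTmul (a i k) (b k j) := by
  ext i j
  simp only [Matrix.mul_apply, Matrix.map_apply, Matrix.of_apply, minTensorLeft_mul_minTensorRight]

lemma commute_pow_minTensorLeft_pow_minTensorRight (c c' : Colour) (a : A) (b : B) :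
    Commute (c.pow (minTensorLeft (B := B) a)) (c'.pow (minTensorRight b)) := by
  rw [← Colour.map_pow, ← Colour.map_pow]
  exact commute_minTensorLeft_minTensorRight _ _

variable [NeZero N]

lemma SpaceRelations.minTmul {p : TwoColouredPartition} {a : Matrix (Fin N) (Fin N) A}
    {b : Matrix (Fin N) (Fin N) B} (ha : p.SpaceRelations le_rfl a)
    (hb : p.SpaceRelations le_rfl b) :
    p.SpaceRelations le_rfl fun i j => ∑ k, minTmul (a i k) (b k j) := by
  have h := SpaceRelations.mul (x := a.map minTensorLeft) (y := b.map minTensorRight)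
    (fun c c' _ _ _ _ => commute_pow_minTensorLeft_pow_minTensorRight c c' _ _)
    (ha.map minTensorLeft) (hb.map minTensorRight)
  rwa [map_minTensorLeft_mul_map_minTensorRight] at h

lemma Admissible.minTmul {P : Set TwoColouredPartition} {a : Matrix (Fin N) (Fin N) A}
    {b : Matrix (Fin N) (Fin N) B} (ha : Admissible P a) (hb : Admissible P b) :
    Admissible P (.of fun i j => ∑ k, minTmul (a i k) (b k j)) := by
  rw [← map_minTensorLeft_mul_map_minTensorRight]
  exact (ha.map minTensorLeft).mul
    (fun c c' _ _ _ _ => commute_pow_minTensorLeft_pow_minTensorRight c c' _ _)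
    (hb.map minTensorRight)

end MinTensor

end TwoColouredPartition

/-! ### Quantum symmetry groups -/

section Actions

variable {N : ℕ} {P : Set TwoColouredPartition} (hP : mixedPairs ⊆ P)

lemma spaceRelations_pqsGen {d : ℕ} (hd : d ≤ N) {p : TwoColouredPartition} (hp : p ∈ P) :
    p.SpaceRelations hd (pqsGen.{u} N d hd P hP) :=
  spaceRelations_gen (pqsRelations.{u} N d hd P hP) (fun i j => ⟨(i, j)⟩) fun _ _ _ hy => hy p hp

lemma exists_pqs_lift {d : ℕ} (hd : d ≤ N) {B : Type u} [CStarAlgebra B] {y : Fin N → Fin d → B}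
    (hy : ∀ p ∈ P, p.SpaceRelations hd y) :
    ∃ φ : PQS.{u} N d hd P hP →⋆ₐ[ℂ] B, ∀ i j, φ (pqsGen N d hd P hP i j) = y i j := by
  obtain ⟨φ, hφ⟩ := (pqsRelations.{u} N d hd P hP).exists_lift
    (y := fun ij => y ij.down.1 ij.down.2) hy
  exact ⟨φ, fun i j => hφ ⟨(i, j)⟩⟩

variable [NeZero N]

/-- Represent `C(X_{N,N}(P))` by evaluation at the classical point given by the unit matrix: this
turns the image of `x_{ij}` under the action into `v_{ij} ⊗ 1`. -/
lemma spaceRelations_of_action {A : Type u} [CStarAlgebra A] {v : Matrix (Fin N) (Fin N) A}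
    (α : PQS.{u} N N le_rfl P hP →⋆ₐ[ℂ] MinTensor A (PQS.{u} N N le_rfl P hP))
    (hα : ∀ i j, α (pqsGen N N le_rfl P hP i j) =
      ∑ k, minTmul (v i k) (pqsGen N N le_rfl P hP k j))
    {p : TwoColouredPartition} (hp : p ∈ P) : p.SpaceRelations le_rfl v := by
  refine spaceRelations_iff_relator.2 fun a ha => ?_
  by_contra hne
  obtain ⟨H, _, _, _, π, hπ⟩ := exists_representation_ne_zero hne
  have : Nontrivial H := not_subsingleton_iff_nontrivial.1 fun _ => hπ (Subsingleton.elim _ _)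
  obtain ⟨ε, hε⟩ := exists_pqs_lift hP le_rfl (B := H →L[ℂ] H)
    (y := (1 : Matrix (Fin N) (Fin N) (H →L[ℂ] H))) fun p _ => spaceRelations_one p
  obtain ⟨φ, hφ⟩ := exists_tensorRep_lift π ε
  have hφ_left (b : A) : φ.comp minTensorLeft b = opTensor (π b) (1 : H →L[ℂ] H) :=
    (hφ b 1).trans (by rw [map_one])
  have hφ_action (i j : Fin N) :
      φ.comp α (pqsGen N N le_rfl P hP i j) = φ.comp minTensorLeft (v i j) := by
    have hzero (S : H →L[ℂ] H) : opTensor S (0 : H →L[ℂ] H) = 0 := by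
      simpa using opTensor_smul_right 0 S (0 : H →L[ℂ] H)
    rw [hφ_left, StarAlgHom.comp_apply, hα, map_sum,
      Finset.sum_eq_single_of_mem j (Finset.mem_univ j) fun k _ hk => by
        rw [hφ, hε, Matrix.one_apply_ne hk, hzero], hφ, hε, Matrix.one_apply_eq]
  have hrelations : p.SpaceRelations le_rfl fun i j => φ.comp minTensorLeft (v i j) := by
    simpa only [hφ_action] using (spaceRelations_pqsGen hP le_rfl hp).map (φ.comp α)
  refine hπ (eq_zero_of_opTensor_one_eq_zero (K := H) ?_)
  rw [← hφ_left, (spaceRelations_map_iff _).1 hrelations a ha]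

theorem hasActions_pqsGen_iff (G : CMQG.{u} N) :
    G.HasActions (pqsGen.{u} N N le_rfl P hP) ↔ Admissible P G.u := by
  constructor
  · rintro ⟨⟨α, hα⟩, β, hβ⟩ p hp
    exact ⟨spaceRelations_of_action hP α hα hp, spaceRelations_of_action (v := G.uᵀ) hP β hβ hp⟩
  · intro h
    exact ⟨exists_pqs_lift hP le_rfl fun p hp =>
        (h p hp).1.minTmul (spaceRelations_pqsGen hP le_rfl hp),
      exists_pqs_lift hP le_rfl fun p hp =>
        (h p hp).2.minTmul (spaceRelations_pqsGen hP le_rfl hp)⟩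

end Actions

section EasyQuantumGroup

variable (N : ℕ) {P : Set TwoColouredPartition} (hP : mixedPairs ⊆ P)

/-- The relations on the entries of a matrix expressing that it is admissible. -/
def admissibleRelations : CStarRelations.{u} (ULift.{u} (Fin N × Fin N)) where
  Holds _ _ y := Admissible P (.of fun i j => y ⟨(i, j)⟩)
  bounded x := ⟨1, fun _ _ y hy => norm_le_one_of_spaceRelations le_rfl (fun i j => y ⟨(i, j)⟩)
    (hy _ (hP (by simp [mixedPairs]))).1 x.down.1 x.down.2⟩

/-- The universal admissible matrix. -/
def admissibleGen : Matrix (Fin N) (Fin N) (admissibleRelations.{u} N hP).Universal :=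
  .of fun i j => (admissibleRelations.{u} N hP).gen ⟨(i, j)⟩

variable {N}

lemma admissible_admissibleGen : Admissible P (admissibleGen.{u} N hP) := fun p hp =>
  ⟨spaceRelations_gen (admissibleRelations.{u} N hP) (fun i j => ⟨(i, j)⟩)
      fun _ _ _ hy => (hy p hp).1,
    spaceRelations_gen (admissibleRelations.{u} N hP) (fun i j => ⟨(j, i)⟩)
      fun _ _ _ hy => (hy p hp).2⟩

lemma exists_admissible_lift {B : Type u} [CStarAlgebra B] {y : Matrix (Fin N) (Fin N) B}
    (hy : Admissible P y) :
    ∃ φ : (admissibleRelations.{u} N hP).Universal →⋆ₐ[ℂ] B,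
      ∀ i j, φ (admissibleGen N hP i j) = y i j := by
  obtain ⟨φ, hφ⟩ := (admissibleRelations.{u} N hP).exists_lift
    (y := fun ij => y ij.down.1 ij.down.2) hy
  exact ⟨φ, fun i j => hφ ⟨(i, j)⟩⟩

variable [NeZero N]

variable (N) in
/-- The easy quantum group of the category of partitions generated by `P`: the largest compact
matrix quantum group whose matrix is admissible. -/
def easyQuantumGroup : CMQG.{u} N where
  carrier := (admissibleRelations.{u} N hP).Universal
  u := admissibleGen N hP
  generates := by
    rw [← (admissibleRelations.{u} N hP).adjoin_gen_topologicalClosure]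
    congr 2
    exact Equiv.ulift.symm.surjective.range_comp (admissibleRelations.{u} N hP).gen
  isUnit := (admissible_admissibleGen hP).isUnit hP
  isUnit_conj := (admissible_admissibleGen hP).isUnit_conj hP
  exists_comul := exists_admissible_lift hP
    ((admissible_admissibleGen hP).minTmul (admissible_admissibleGen hP))

lemma isQuantumSymmetryGroup_easyQuantumGroup :
    (easyQuantumGroup.{u} N hP).IsQuantumSymmetryGroup (pqsGen.{u} N N le_rfl P hP) where
  hasActions := (hasActions_pqsGen_iff hP _).2 (admissible_admissibleGen hP)
  maximal G' hG' := exists_admissible_lift hP ((hasActions_pqsGen_iff hP G').1 hG')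

end EasyQuantumGroup

namespace CMQG

variable {N : ℕ}

lemma Same.of_isSubgroup {G G' : CMQG.{u} N} (h : G.IsSubgroup G') (h' : G'.IsSubgroup G) :
    G.Same G' := by
  obtain ⟨φ, hφ⟩ := h
  obtain ⟨ψ, hψ⟩ := h'
  refine ⟨StarAlgEquiv.ofStarAlgHom ψ φ
    (starAlgHom_eq_of_eqOn_generators G.generates ?_)
    (starAlgHom_eq_of_eqOn_generators G'.generates ?_), hψ⟩ <;>
  · rintro _ ⟨ij, rfl⟩
    simp [hψ, hφ]

variable {d d' : ℕ} {B B' : Type u} [CStarAlgebra B] [CStarAlgebra B'] {x : Fin N → Fin d → B}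
  {x' : Fin N → Fin d' → B'}

lemma isQuantumSymmetryGroup_congr (h : ∀ G : CMQG.{u} N, G.HasActions x ↔ G.HasActions x')
    (G : CMQG.{u} N) : G.IsQuantumSymmetryGroup x ↔ G.IsQuantumSymmetryGroup x' :=
  ⟨fun hG => ⟨(h G).1 hG.hasActions, fun G' hG' => hG.maximal G' ((h G').2 hG')⟩,
    fun hG => ⟨(h G).2 hG.hasActions, fun G' hG' => hG.maximal G' ((h G').1 hG')⟩⟩

lemma IsQuantumSymmetryGroup.same {G G' : CMQG.{u} N} (hG : G.IsQuantumSymmetryGroup x)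
    (hG' : G'.IsQuantumSymmetryGroup x) : G.Same G' :=
  .of_isSubgroup (hG'.maximal G hG.hasActions) (hG.maximal G' hG'.hasActions)

end CMQG

end

theorem mainTheorem5 (N : ℕ) (hN : 0 < N) (P P' : Set TwoColouredPartition)
    (hP : TwoColouredPartition.mixedPairs ⊆ P) (hP' : TwoColouredPartition.mixedPairs ⊆ P')
    (h : TwoColouredPartition.generatedCategory P = TwoColouredPartition.generatedCategory P') :
    (∃ G : CMQG.{u} N, G.IsQuantumSymmetryGroup (pqsGen.{u} N N le_rfl P hP)) ∧
    (∀ G : CMQG.{u} N, G.IsQuantumSymmetryGroup (pqsGen.{u} N N le_rfl P hP) ↔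
      G.IsQuantumSymmetryGroup (pqsGen.{u} N N le_rfl P' hP')) ∧
    (∀ G G' : CMQG.{u} N, G.IsQuantumSymmetryGroup (pqsGen.{u} N N le_rfl P hP) →
      G'.IsQuantumSymmetryGroup (pqsGen.{u} N N le_rfl P' hP') → G.Same G') := by
  have : NeZero N := ⟨hN.ne'⟩
  have hactions (G : CMQG.{u} N) : G.HasActions (pqsGen.{u} N N le_rfl P hP) ↔
      G.HasActions (pqsGen.{u} N N le_rfl P' hP') := by
    rw [hasActions_pqsGen_iff, hasActions_pqsGen_iff,
      TwoColouredPartition.admissible_congr hP hP' h]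
  have hiff := CMQG.isQuantumSymmetryGroup_congr hactions
  exact ⟨⟨easyQuantumGroup N hP, isQuantumSymmetryGroup_easyQuantumGroup hP⟩, hiff,
    fun G G' hG hG' => hG.same ((hiff G').2 hG')⟩
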